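/- **Setting.** There are $N\ge 1$ agents on an undirected graph; $Nb(i)$ denotes the set consisting of $i$ and its neighbours. Agent $i$ has a sample distribution $\mathcal D_i$ and a loss $\mathcal F^i(\mathbf W;\xi)$, differentiable in $\mathbf W\in\mathbb R^{d\times k}$; put $f^i(\mathbf W)=\mathbb E_{\xi\sim\mathcal D_i}[\mathcal F^i(\mathbf W;\xi)]$. Let $1\le r\le k$, $\eta>0$, let $\mathbf W_0\in\mathbb R^{d\times k}$ and $\mathbf A_0\in\mathbb R^{r\times k}$ be frozen, and write $f^i(\mathbf B)=f^i(\mathbf W_0+\frac{\eta}{r}\mathbf B\mathbf A_0)$, $\mathcal F^i(\mathbf B;\xi)=\mathcal F^i(\mathbf W_0+\frac{\eta}{r}\mathbf B\mathbf A_0;\xi)$ and $f(\mathbf B)=\frac1N\sum_{i=1}^N f^i(\mathbf B)$ for $\mathbf B\in\mathbb R^{d\times r}$. DLoRA-FA with step size $\alpha$, communication at every step, and deterministic initial factors $\mathbf B^i_1$ is the iteration $$\mathbf B^i_{t+1}=\sum_{j\in Nb(i)}\pi_{ij}\mathbf B^j_t-\alpha\,\frac1{|\mathcal S^i_t|}\sum_{s\in\mathcal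 S^i_t}\nabla_{\mathbf B}\mathcal F^i(\mathbf B^i_t;\xi_s),\qquad t=1,2,\dots,$$ where the mini-batches $\mathcal S^i_t$ (of a nonzero size depending only on $i$) are independent over $i$ and $t$ and each of their elements has law $\mathcal D_i$. Put $\bar{\mathbf B}_t=\frac1N\sum_{i}\mathbf B^i_t$. **Assumptions.** With $\|\cdot\|$ the Frobenius norm: (1) each $f^i$ is differentiable on $\mathbb R^{d\times k}$ and $\|\nabla f^i(\mathbf W)-\nabla f^i(\mathbf W')\|\le L\|\mathbf W-\mathbf W'\|$ for all $\mathbf W,\mathbf W'$, where $L>0$; (2) for all $i$ and $\mathbf B$, $\mathbb E_{\xi\sim\mathcal D_i}[\nabla_{\mathbf B}\mathcal F^i(\mathbf B;\xi)]=\nabla_{\mathbf B} f^i(\mathbf B)$ and $\mathbb E_{\xi\sim\mathcal D_i}\|\nabla_{\mathbf B}\mathcal F^i(\mathbf B;\xi)-\nabla_{\mathbf B} f^i(\mathbf B)\|^2\le\zeta^2$, and $\frac1N\sum_{i}\|\nabla_{\mathbf B} f^i(\mathbf B)-\nabla_{\mathbf B} f(\mathbf B)\|^2\le\kappa^2$,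 where $\zeta,\kappa>0$; (3) $\mathbf\Pi=(\pi_{ij})\in\mathbb R^{N\times N}$ is symmetric and doubly stochastic with $\pi_{ij}=0$ for $j\notin Nb(i)$, and its eigenvalues $\lambda_1\ge\dots\ge\lambda_N$ satisfy $\lambda_1=1$ and $|\lambda_l|\le\sqrt\rho$ for $l\ge2$, where $0<\rho<1$; (4) $f$ is bounded below on $\mathbb R^{d\times r}$, $f(\bar{\mathbf B}_1)-\inf_{\mathbf B} f(\mathbf B)\le D$ and $\frac1N\sum_i\|\mathbf B_1^i\|^2\le R^2$ (where $R=0$ is the usual initialization $\mathbf B^i_1=0$). **Statement.** Let $\tilde L=\eta^2L\bigl(1+\frac kr+\frac{2\sqrt k}{r^{1.5}}\bigr)$. For all $L,\eta,\zeta,\kappa,D,R$ and every $c>0$ there is a constant $C>0$, depending only on these seven numbers, such that the following holds for all $1\le r\le k$. If $\mathbf A_0$ has independent $\mathcal N(0,1)$ entries, then $\|\mathbf A_0\|\le r+\sqrt{kr}$ with probability at least $1-e^{-r^2/2}$. For every $\mathbf A_0$ with $\|\mathbf A_0\|\le r+\sqrt{kr}$, all $N,d$, all $\rho\in(0,1)$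 and all tasks, graphs, mixing matrices, mini-batches and initializations as above, if $c\sqrt{N/T}\le\alpha\le\sqrt{N/T}$ and $T\ge\frac{32N\tilde L^2}{(1-\sqrt\rho)^2}$, then $\|\nabla_{\mathbf B} f(\bar{\mathbf B}_t)\|^2$ is integrable for every $t$ and $$\frac1T\sum_{t=1}^T\mathbb E\bigl[\|\nabla_{\mathbf B} f(\bar{\mathbf B}_t)\|^2\bigr]\le C\left(\frac1{\sqrt{NT}}+\frac{k}{r\sqrt{NT}}+\frac{Nk^2}{(1-\rho)Tr^2}+\frac{Nk^2}{(1-\sqrt\rho)^2Tr^2}\right),$$ where the expectation is over the mini-batches, for the given $\mathbf A_0$. -/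

import Mathlib

open MeasureTheory ProbabilityTheory

namespace DLoRAFA

noncomputable section

/-- Real `m × n` matrices, flattened: the Euclidean norm of this space is the Frobenius norm, and
Mathlib's `gradient` on it is the usual matrix of partial derivatives. -/
abbrev Mat (m n : ℕ) : Type := EuclideanSpace ℝ (Fin m × Fin n)

/-- The matrix product. -/
def Mat.mul {d r k : ℕ} (B : Mat d r) (A : Mat r k) : Mat d k :=
  WithLp.toLp 2 fun p => ∑ l : Fin r, B (p.1, l) * A (l, p.2)

/-- The law of a random `r × k` matrix with independent standard normal entries. -/
def gaussianMat (r k : ℕ) : Measure (Mat r k) :=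
  (Measure.pi fun _ : Fin r × Fin k => gaussianReal 0 1).map (WithLp.toLp 2)

/-- The low-rank parametrization `W = W₀ + (η / r) B A₀`. -/
def lora {d r k : ℕ} (η : ℝ) (W₀ : Mat d k) (A₀ : Mat r k) (B : Mat d r) : Mat d k :=
  W₀ + (η / r) • Mat.mul B A₀

/-- The smoothness constant `η² L (1 + k / r + 2 √k / r^(3/2))`. -/
def Ltilde (L η : ℝ) (k r : ℕ) : ℝ :=
  η ^ 2 * L * (1 + (k : ℝ) / r + 2 * √(k : ℝ) / (r : ℝ) ^ (3 / 2 : ℝ))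

/-- The data of a decentralized fine-tuning task with `N` agents: the pre-trained weights, and for
each agent `i` the distribution of its samples and its loss `F i W z` at weights `W` on the
sample `z`. -/
structure Task (N d k : ℕ) (Z : Type*) [MeasurableSpace Z] where
  W₀ : Mat d k
  dist : Fin N → Measure Z
  F : Fin N → Mat d k → Z → ℝ

namespace Task

variable {N d k r : ℕ} {Z : Type*} [MeasurableSpace Z]

/-- The local objective of agent `i` as a function of the full weights, `fⁱ(W) = E F i W z`. -/
def f (P : Task N d k Z) (i : Fin N) (W : Mat d k) : ℝ :=
  ∫ z, P.F i W z ∂(P.dist i)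

/-- The local objective of agent `i` as a function of the trainable factor `B`. -/
def fB (P : Task N d k Z) (η : ℝ) (A₀ : Mat r k) (i : Fin N) (B : Mat d r) : ℝ :=
  P.f i (lora η P.W₀ A₀ B)

/-- The global objective as a function of the trainable factor `B`. -/
def obj (P : Task N d k Z) (η : ℝ) (A₀ : Mat r k) (B : Mat d r) : ℝ :=
  (1 / (N : ℝ)) * ∑ i, P.fB η A₀ i B

/-- The gradient with respect to `B` of the loss of agent `i` on the sample `z`. -/
def sampleGrad (P : Task N d k Z) (η : ℝ) (A₀ : Mat r k) (i : Fin N) (B : Mat d r) (z : Z) :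
    Mat d r :=
  gradient (fun B' => P.F i (lora η P.W₀ A₀ B') z) B

/-- The stochastic gradient of agent `i` over the mini-batch `S`. -/
def batchGrad (P : Task N d k Z) (η : ℝ) (A₀ : Mat r k) (i : Fin N) {b : ℕ} (S : Fin b → Z)
    (B : Mat d r) : Mat d r :=
  (1 / (b : ℝ)) • ∑ s, P.sampleGrad η A₀ i B (S s)

/-- The objective makes sense, and the sample gradients with respect to `B` are unbiased. -/
structure WellPosed (P : Task N d k Z) (η : ℝ) (A₀ : Mat r k) : Prop where
  prob : ∀ i, IsProbabilityMeasure (P.dist i)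
  meas : ∀ i W, Measurable (P.F i W)
  diff : ∀ i z, Differentiable ℝ fun W => P.F i W z
  integrable : ∀ i W, Integrable (P.F i W) (P.dist i)
  unbiased : ∀ i (B : Mat d r),
    ∫ z, P.sampleGrad η A₀ i B z ∂(P.dist i) = gradient (P.fB η A₀ i) B

/-- Every local objective is `L`-smooth as a function of the full weights. -/
def Smooth (P : Task N d k Z) (L : ℝ) : Prop :=
  ∀ i, Differentiable ℝ (P.f i) ∧
    ∀ W W' : Mat d k, ‖gradient (P.f i) W - gradient (P.f i) W'‖ ≤ L * ‖W - W'‖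

/-- The variance of the sample gradients is at most `ζ²` at every agent. -/
def BoundedVariance (P : Task N d k Z) (η : ℝ) (A₀ : Mat r k) (ζ : ℝ) : Prop :=
  ∀ i (B : Mat d r),
    ∫⁻ z, ENNReal.ofReal (‖P.sampleGrad η A₀ i B z - gradient (P.fB η A₀ i) B‖ ^ 2) ∂(P.dist i)
      ≤ ENNReal.ofReal (ζ ^ 2)

/-- The gradient diversity among the agents is at most `κ²`. -/
def BoundedDiversity (P : Task N d k Z) (η : ℝ) (A₀ : Mat r k) (κ : ℝ) : Prop :=
  ∀ B : Mat d r,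
    (1 / (N : ℝ)) * ∑ i, ‖gradient (P.fB η A₀ i) B - gradient (P.obj η A₀) B‖ ^ 2 ≤ κ ^ 2

end Task

/-- `Nb(i)`: the neighbours of `i` in the communication graph, and `i` itself. -/
def Nb {N : ℕ} (G : SimpleGraph (Fin N)) (i : Fin N) : Finset (Fin N) :=
  open Classical in Finset.univ.filter fun j => j = i ∨ G.Adj i j

/-- `M` is a symmetric doubly stochastic matrix, with weights only along the edges of `G` and on
the diagonal, whose eigenvalues `λ₁ ≥ λ₂ ≥ … ≥ λ_N` satisfy `λ₁ = 1` and `|λ_l| ≤ √ρ` for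
`l ≥ 2`, that is `max {|λ₂|, |λ_N|} ≤ √ρ`. (`eigenvalues₀` lists the eigenvalues in decreasing
order, starting with the index `0`.) -/
structure IsMixing {N : ℕ} (G : SimpleGraph (Fin N)) (M : Matrix (Fin N) (Fin N) ℝ) (ρ : ℝ) :
    Prop where
  symm : M.IsHermitian
  stochastic : M ∈ doublyStochastic ℝ (Fin N)
  support : ∀ i j, j ∉ Nb G i → M i j = 0
  eig_one : ∀ l : Fin (Fintype.card (Fin N)), (l : ℕ) = 0 → symm.eigenvalues₀ l = 1
  eig_le : ∀ l : Fin (Fintype.card (Fin N)), 1 ≤ (l : ℕ) → |symm.eigenvalues₀ l| ≤ √ρ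

/-- `ξ t i` is the mini-batch, of size `b i`, that agent `i` draws at step `t`: each of its
elements has law `dist i`, and the batches of different agents or steps are independent. -/
structure IsSampling {N : ℕ} {Ω Z : Type*} [MeasurableSpace Ω] [MeasurableSpace Z]
    (μ : Measure Ω) (dist : Fin N → Measure Z) (b : Fin N → ℕ)
    (ξ : ℕ → (i : Fin N) → Ω → Fin (b i) → Z) : Prop where
  size_pos : ∀ i, 0 < b i
  meas : ∀ t i, Measurable (ξ t i)
  law : ∀ t i s, μ.map (fun ω => ξ t i ω s) = dist i
  indep : iIndepFun (fun p : ℕ × Fin N => ξ p.1 p.2) μ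

/-- The iterates of DLoRA-FA with communication at every step, step size `α`, frozen `A₀`, initial
factors `B₁ i` and mini-batches `S`. The steps are counted from `0` here, so that the value at `t`
is the family of factors with which the `(t + 1)`-st iteration starts; the value at `0` is `B₁`. -/
def iterates {N d k r : ℕ} {Z : Type*} [MeasurableSpace Z] (P : Task N d k Z) (η : ℝ)
    (A₀ : Mat r k) (G : SimpleGraph (Fin N)) (M : Matrix (Fin N) (Fin N) ℝ) (α : ℝ)
    {b : Fin N → ℕ} (B₁ : Fin N → Mat d r) (S : ℕ → (i : Fin N) → Fin (b i) → Z) :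
    ℕ → Fin N → Mat d r
  | 0 => B₁
  | t + 1 => fun i =>
      (∑ j ∈ Nb G i, M i j • iterates P η A₀ G M α B₁ S t j)
        - α • P.batchGrad η A₀ i (S t i) (iterates P η A₀ G M α B₁ S t i)

/-- The average of the factors of the agents. -/
def avg {N d r : ℕ} (B : Fin N → Mat d r) : Mat d r :=
  (1 / (N : ℝ)) • ∑ i, B i

end

end DLoRAFA

namespace DLoRAFA

/-! ### The Frobenius norm of a Gaussian matrix -/

/-! The squared Frobenius norm of a Gaussian matrix is a `χ²` variable with `r k` degrees of
freedom, and a Chernoff bound (`chiSq_tail`) gives the probability of the event for `A₀`. On that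
event the linear map `B ↦ (η / r) B A₀` has operator norm at most `(η / r) (r + √(kr))`, so every
local objective is `K`-smooth in `B` with `K = 2 L̃` (`sq_norm_le_Ltilde`). From then on this is
decentralized SGD on `K`-smooth functions.

Split each stochastic gradient into the true gradient and a noise. Two inequalities drive the proof.
Consensus: on vectors of mean zero the mixing matrix contracts by `√ρ`, so the expected `dispersion`
shrinks by the factor `1 - 3 (1 - √ρ) / 4` at each step, up to `α²` times gradient diversity and
noise (`IsMixing.integral_dispersion_succ_le`). Descent: the average moves along the mean of the
local gradients, and smoothness bounds the decrease of the objective, with an error `K² / N` times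
the dispersion (`IsMixing.descent_gossipStep`).

The batch of an agent at a step is independent of the current state and of the other batches, so by
Fubini the noise is orthogonal to functions of the state and uncorrelated between agents
(`uncorrelatedNoise_iterates`). The averaged noise therefore has variance at most `ζ² / N`, the
source of the linear speedup. Summing over `T` steps and inserting `α` of order `√(N / T)` gives the
rate (`rate_le`). -/

lemma exp_mul_sq_gaussian {s : ℝ} (hs : s < 1 / 2) :
    ∫ x, Real.exp (s * x ^ 2) ∂(gaussianReal 0 1) = (√(1 - 2 * s))⁻¹ := by
  rw [integral_gaussianReal_eq_integral_smul one_ne_zero]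
  have h : ∀ x : ℝ, gaussianPDFReal 0 1 x • Real.exp (s * x ^ 2)
      = (√(2 * Real.pi))⁻¹ * Real.exp (-(1 / 2 - s) * x ^ 2) := by
    intro x
    simp only [gaussianPDFReal, smul_eq_mul, NNReal.coe_one, mul_one, sub_zero]
    rw [mul_assoc, ← Real.exp_add]
    congr 2
    ring
  simp_rw [h]
  rw [integral_const_mul, integral_gaussian, ← Real.sqrt_inv, ← Real.sqrt_inv, ← Real.sqrt_mul
    (by positivity)]
  congr 1
  have : (1 : ℝ) / 2 - s ≠ 0 := by linarith
  have h2 : (1 : ℝ) - 2 * s ≠ 0 := by linarith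
  have := Real.pi_ne_zero
  field_simp

/-- A non-integrable function has Bochner integral `0` by convention, while the value computed above
is positive. -/
lemma integrable_exp_mul_sq_gaussian {s : ℝ} (hs : s < 1 / 2) :
    Integrable (fun x : ℝ => Real.exp (s * x ^ 2)) (gaussianReal 0 1) := by
  by_contra h
  have h0 := integral_undef h
  rw [exp_mul_sq_gaussian hs] at h0
  have : 0 < √(1 - 2 * s) := Real.sqrt_pos.2 (by linarith)
  exact (inv_pos.2 this).ne' h0

/-- The upper tail of the `χ²` distribution. -/
lemma chiSq_tail {ι : Type*} [Fintype ι] [Nonempty ι] {u : ℝ} (hu : 0 < u) :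
    (Measure.pi fun _ : ι => gaussianReal 0 1).real
        {x | (Fintype.card ι : ℝ) * (1 + u) ^ 2 ≤ ∑ i, x i ^ 2}
      ≤ Real.exp (-(Fintype.card ι * u ^ 2) / 2) := by
  set n := Fintype.card ι
  -- The optimal Chernoff parameter: `1 - 2 s = (1 + u)⁻²`, so the moment generating function is `(1
  -- + u) ^ n` and `s (1 + u) ^ 2 = u + u ^ 2 / 2`. The bound `1 + u ≤ exp u` then cancels the
  -- linear term.
  set s : ℝ := (1 - ((1 + u) ^ 2)⁻¹) / 2 with hs
  have hu1 : 0 < (1 + u) ^ 2 := by positivity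
  have hi : 0 < ((1 + u) ^ 2)⁻¹ := by positivity
  have hs2 : s < 1 / 2 := by rw [hs]; linarith
  have hs0 : 0 ≤ s := by
    have : ((1 + u) ^ 2)⁻¹ ≤ 1 := inv_le_one_of_one_le₀ (by nlinarith)
    rw [hs]; linarith
  have hexp : ∀ x : ι → ℝ, Real.exp (s * ∑ i, x i ^ 2) = ∏ i, Real.exp (s * x i ^ 2) := by
    intro x; rw [Finset.mul_sum, Real.exp_sum]
  have hint : Integrable (fun x : ι → ℝ => Real.exp (s * ∑ i, x i ^ 2))
      (Measure.pi fun _ : ι => gaussianReal 0 1) := by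
    simp_rw [hexp]
    exact Integrable.fintype_prod (fun _ => integrable_exp_mul_sq_gaussian hs2)
  refine (measure_ge_le_exp_mul_mgf (X := fun x : ι → ℝ => ∑ i, x i ^ 2) _ hs0 hint).trans ?_
  have hmgf : mgf (fun x : ι → ℝ => ∑ i, x i ^ 2) (Measure.pi fun _ : ι => gaussianReal 0 1) s
      = (1 + u) ^ n := by
    unfold mgf
    simp_rw [hexp]
    rw [integral_fintype_prod_eq_pow (fun y : ℝ => Real.exp (s * y ^ 2)), exp_mul_sq_gaussian hs2]
    congr 1
    have : 1 - 2 * s = ((1 + u) ^ 2)⁻¹ := by rw [hs]; ring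
    rw [this, Real.sqrt_inv, inv_inv, Real.sqrt_sq (by linarith)]
  rw [hmgf]
  have h1 : (1 + u) ^ n ≤ Real.exp (n * u) := by
    rw [Real.exp_nat_mul]
    exact pow_le_pow_left₀ (by linarith) (by linarith [Real.add_one_le_exp u]) n
  refine (mul_le_mul_of_nonneg_left h1 (Real.exp_pos _).le).trans ?_
  rw [← Real.exp_add]
  apply le_of_eq
  congr 1
  rw [hs]
  field_simp
  ring

/-- `chiSq_tail` with `n = k r = w ^ 2` and `u = r / w`: the threshold `n (1 + u) ^ 2` is `(r + w) ^
2` and the exponent `n u ^ 2` is `r ^ 2`. -/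
lemma gaussianMat_norm_le (r k : ℕ) (hr : 1 ≤ r) (hk : r ≤ k) :
    ENNReal.ofReal (1 - Real.exp (-(r : ℝ) ^ 2 / 2)) ≤
      gaussianMat r k {A₀ | ‖A₀‖ ≤ r + √((k : ℝ) * r)} := by
  have hr' : (0 : ℝ) < r := by exact_mod_cast hr
  have hk' : (0 : ℝ) < k := by exact_mod_cast (hr.trans hk)
  have : NeZero r := ⟨by omega⟩
  have : NeZero k := ⟨by omega⟩
  set w := √((k : ℝ) * r) with hw
  have hw0 : 0 < w := Real.sqrt_pos.2 (by positivity)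
  have hw2 : w ^ 2 = k * r := Real.sq_sqrt (by positivity)
  have hcard : ((Fintype.card (Fin r × Fin k) : ℕ) : ℝ) = w ^ 2 := by
    rw [hw2]; simp [mul_comm]
  have hmeas : MeasurableSet {A₀ : Mat r k | ‖A₀‖ ≤ r + w} :=
    measurableSet_le measurable_norm measurable_const
  have htl : Measurable (WithLp.toLp 2 : (Fin r × Fin k → ℝ) → Mat r k) := by fun_prop
  have : IsProbabilityMeasure (gaussianMat r k) := by
    unfold gaussianMat
    exact Measure.isProbabilityMeasure_map htl.aemeasurable
  have htail := chiSq_tail (ι := Fin r × Fin k) (u := r / w) (by positivity)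
  rw [hcard] at htail
  have e1 : w ^ 2 * (1 + r / w) ^ 2 = (r + w) ^ 2 := by field_simp; ring
  have e2 : w ^ 2 * (r / w) ^ 2 = (r : ℝ) ^ 2 := by field_simp
  rw [e1, e2] at htail
  have hc : (gaussianMat r k).real {A₀ | ‖A₀‖ ≤ r + w}ᶜ ≤ Real.exp (-(r : ℝ) ^ 2 / 2) := by
    refine le_trans ?_ htail
    unfold gaussianMat
    rw [map_measureReal_apply htl hmeas.compl]
    refine measureReal_mono ?_
    intro x hx
    simp only [Set.mem_preimage, Set.mem_compl_iff, Set.mem_ofPred_eq, not_le] at hx ⊢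
    have h3 : ‖WithLp.toLp 2 x‖ ^ 2 = ∑ i, x i ^ 2 := by
      rw [EuclideanSpace.norm_sq_eq]; simp
    rw [← h3]
    exact pow_le_pow_left₀ (by positivity) hx.le 2
  rw [probReal_compl_eq_one_sub hmeas] at hc
  rw [← ofReal_measureReal]
  exact ENNReal.ofReal_le_ofReal (by linarith)

/-! ### Smooth functions -/

section Smooth

variable {E : Type*} [NormedAddCommGroup E] [InnerProductSpace ℝ E] [CompleteSpace E]

/-- The quadratic upper bound for a function with a Lipschitz gradient. -/
lemma descent_lemma {f : E → ℝ} (hf : Differentiable ℝ f) {K : ℝ}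
    (hK : ∀ x y, ‖gradient f x - gradient f y‖ ≤ K * ‖x - y‖) (x v : E) :
    f (x + v) ≤ f x + inner ℝ (gradient f x) v + K / 2 * ‖v‖ ^ 2 := by
  -- The claim is `φ 1 ≤ φ 0`; the Lipschitz bound along the segment makes `φ' ≤ 0`.
  set φ : ℝ → ℝ := fun s => f (x + s • v) - s * inner ℝ (gradient f x) v - K / 2 * s ^ 2 * ‖v‖ ^ 2
  have hd : ∀ s, HasDerivAt φ (inner ℝ (gradient f (x + s • v)) v - inner ℝ (gradient f x) v
      - K * s * ‖v‖ ^ 2) s := by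
    intro s
    have h1 : HasDerivAt (fun s : ℝ => x + s • v) v s := by
      simpa using ((hasDerivAt_id s).smul_const v).const_add x
    have h2 : HasDerivAt (fun s : ℝ => f (x + s • v))
        (inner ℝ (gradient f (x + s • v)) v) s := by
      have := (hf (x + s • v)).hasFDerivAt.comp_hasDerivAt s h1
      rwa [← inner_gradient_left] at this
    have h3 := (h2.sub ((hasDerivAt_id s).mul_const (inner ℝ (gradient f x) v))).sub
      ((((hasDerivAt_id s).pow 2).const_mul (K / 2)).mul_const (‖v‖ ^ 2))
    convert! h3 using 1
    simp only [id_eq, one_mul]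
    ring
  have hanti : AntitoneOn φ (Set.Icc 0 1) := by
    refine antitoneOn_of_deriv_nonpos (convex_Icc 0 1)
      (fun s _ => (hd s).continuousAt.continuousWithinAt)
      (fun s _ => (hd s).differentiableAt.differentiableWithinAt) ?_
    intro s hs
    rw [interior_Icc] at hs
    rw [(hd s).deriv, ← inner_sub_left]
    have h1 := real_inner_le_norm (gradient f (x + s • v) - gradient f x) v
    have h2 := hK (x + s • v) x
    rw [add_sub_cancel_left, norm_smul, Real.norm_of_nonneg hs.1.le] at h2
    have h3 := mul_le_mul_of_nonneg_right h2 (norm_nonneg v)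
    nlinarith
  have h := hanti (Set.left_mem_Icc.2 zero_le_one) (Set.right_mem_Icc.2 zero_le_one) zero_le_one
  simp only [φ, one_smul, zero_smul, add_zero] at h
  linarith

/-- The chain rule for the gradient of a composition with an affine map. -/
lemma hasGradientAt_comp_affine {F : Type*} [NormedAddCommGroup F] [InnerProductSpace ℝ F]
    [CompleteSpace F] {f : F → ℝ} (hf : Differentiable ℝ f) (w : F) (A : E →L[ℝ] F) (x : E) :
    HasGradientAt (fun y => f (w + A y)) (A.adjoint (gradient f (w + A x))) x := by
  rw [hasGradientAt_iff_hasFDerivAt]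
  have h1 : HasFDerivAt (fun y => w + A y) A x := A.hasFDerivAt.const_add w
  have h2 := (hf (w + A x)).hasFDerivAt.comp x h1
  convert! h2 using 1
  ext v
  simp [ContinuousLinearMap.adjoint_inner_left, inner_gradient_left]

/-- One factor `a` comes from `A` inside the gradient, the other from its adjoint outside. -/
lemma gradient_comp_affine_lipschitz {F : Type*} [NormedAddCommGroup F] [InnerProductSpace ℝ F]
    [CompleteSpace F] {f : F → ℝ} (hf : Differentiable ℝ f) {L a : ℝ} (hL : 0 ≤ L)
    (hlip : ∀ x y, ‖gradient f x - gradient f y‖ ≤ L * ‖x - y‖) (w : F) (A : E →L[ℝ] F)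
    (hA : ‖A‖ ≤ a) (x y : E) :
    ‖gradient (fun y => f (w + A y)) x - gradient (fun y => f (w + A y)) y‖
      ≤ a ^ 2 * L * ‖x - y‖ := by
  rw [(hasGradientAt_comp_affine hf w A x).gradient, (hasGradientAt_comp_affine hf w A y).gradient,
    ← map_sub]
  have ha : 0 ≤ a := (norm_nonneg _).trans hA
  have h1 : ‖A x - A y‖ ≤ a * ‖x - y‖ := by
    rw [← map_sub]; exact A.le_of_opNorm_le hA _
  have h2 := hlip (w + A x) (w + A y)
  rw [add_sub_add_left_eq_sub] at h2
  have h3 : ‖A.adjoint‖ ≤ a := by simpa using hA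
  refine (A.adjoint.le_of_opNorm_le h3 _).trans ?_
  calc a * ‖gradient f (w + A x) - gradient f (w + A y)‖
      ≤ a * (L * (a * ‖x - y‖)) := by gcongr; exact h2.trans (by gcongr)
    _ = a ^ 2 * L * ‖x - y‖ := by ring

end Smooth

/-- The gradient of a family of differentiable functions depends measurably on the point and the
parameter. -/
lemma measurable_gradient_uncurry {ι Z : Type*} [Fintype ι] [MeasurableSpace Z]
    {φ : EuclideanSpace ℝ ι → Z → ℝ} (hφ : ∀ z, Differentiable ℝ fun x => φ x z)
    (hm : ∀ x, Measurable (φ x)) :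
    Measurable fun p : EuclideanSpace ℝ ι × Z => gradient (fun x => φ x p.2) p.1 := by
  classical
  have hj : Measurable (Function.uncurry φ) :=
    measurable_uncurry_of_continuous_of_measurable (fun z => (hφ z).continuous) hm
  suffices h : Measurable fun p : EuclideanSpace ℝ ι × Z =>
      (WithLp.ofLp (gradient (fun x => φ x p.2) p.1) : ι → ℝ) by
    have := (WithLp.measurable_toLp 2 (ι → ℝ)).comp h
    exact this
  rw [measurable_pi_iff]
  intro i
  set e : EuclideanSpace ℝ ι := EuclideanSpace.single i 1
  -- Each partial derivative is a limit of difference quotients, which are measurable because `φ` is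
  -- jointly measurable, being continuous in `x` and measurable in `z`.
  refine measurable_of_tendsto_metrizable (f := fun (n : ℕ) (p : EuclideanSpace ℝ ι × Z) =>
    (n : ℝ) * (φ (p.1 + (n : ℝ)⁻¹ • e) p.2 - φ p.1 p.2)) ?_ ?_
  · intro n
    have h1 : Measurable fun p : EuclideanSpace ℝ ι × Z => φ (p.1 + (n : ℝ)⁻¹ • e) p.2 :=
      hj.comp (f := fun p : EuclideanSpace ℝ ι × Z => (p.1 + (n : ℝ)⁻¹ • e, p.2)) (by fun_prop)
    exact (h1.sub hj).const_mul _
  · rw [tendsto_pi_nhds]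
    intro p
    have h1 := (hφ p.2 p.1).hasFDerivAt.lim e (c := fun n : ℕ => (n : ℝ)) (l := Filter.atTop)
      (by simpa using tendsto_natCast_atTop_atTop (R := ℝ))
    have h2 : fderiv ℝ (fun x => φ x p.2) p.1 e = gradient (fun x => φ x p.2) p.1 i := by
      rw [← inner_gradient_left, EuclideanSpace.inner_single_right]
      simp
    rw [h2] at h1
    simpa using h1

/-! ### The low-rank parametrization -/

section Lora

variable {d r k : ℕ}

/-- Cauchy–Schwarz in every entry of the product. -/
lemma Mat.norm_mul_le (B : Mat d r) (A : Mat r k) : ‖Mat.mul B A‖ ≤ ‖B‖ * ‖A‖ := by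
  refine le_of_sq_le_sq ?_ (by positivity)
  rw [mul_pow, EuclideanSpace.norm_sq_eq, EuclideanSpace.norm_sq_eq, EuclideanSpace.norm_sq_eq]
  simp only [Mat.mul, Real.norm_eq_abs, sq_abs, Fintype.sum_prod_type]
  calc ∑ i, ∑ j, (∑ l, B (i, l) * A (l, j)) ^ 2
      ≤ ∑ i, ∑ j, (∑ l, B (i, l) ^ 2) * ∑ l, A (l, j) ^ 2 := by
        gcongr
        exact Finset.sum_mul_sq_le_sq_mul_sq _ _ _
    _ = _ := by
        simp_rw [← Finset.mul_sum, ← Finset.sum_mul]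
        rw [Finset.sum_comm (f := fun l j => A (l, j) ^ 2)]

/-- The linear part of the low-rank parametrization. -/
noncomputable def loraLin (d : ℕ) (η : ℝ) (A₀ : Mat r k) : Mat d r →L[ℝ] Mat d k :=
  LinearMap.mkContinuous
    { toFun := fun B => (η / r) • Mat.mul B A₀
      map_add' := fun x y => by
        ext p; simp [Mat.mul, add_mul, Finset.sum_add_distrib, mul_add]
      map_smul' := fun c x => by
        ext p; simp [Mat.mul, Finset.mul_sum, mul_assoc, mul_left_comm] }
    (|η / r| * ‖A₀‖) (fun B => by
      simp only [LinearMap.coe_mk, AddHom.coe_mk, norm_smul, Real.norm_eq_abs, mul_assoc]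
      gcongr
      rw [mul_comm ‖A₀‖]
      exact Mat.norm_mul_le B A₀)

lemma lora_eq (η : ℝ) (W₀ : Mat d k) (A₀ : Mat r k) (B : Mat d r) :
    lora η W₀ A₀ B = W₀ + loraLin d η A₀ B := rfl

lemma norm_loraLin_le (η : ℝ) (A₀ : Mat r k) : ‖loraLin d η A₀‖ ≤ |η / r| * ‖A₀‖ :=
  LinearMap.mkContinuous_norm_le _ (by positivity) _

lemma one_le_ratio {r k : ℕ} (hr : 1 ≤ r) (hk : r ≤ k) : (1 : ℝ) ≤ k / r := by
  rw [le_div_iff₀ (by exact_mod_cast hr)]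
  simpa using hk

lemma Ltilde_pos {L η : ℝ} (hL : 0 < L) (hη : 0 < η) (k r : ℕ) : 0 < Ltilde L η k r := by
  unfold Ltilde; positivity

/-- Exactly, `(r + √(kr))² / r² = 1 + k / r + 2 √(k / r)`. The cross term can exceed the `2 √k /
r^(3/2)` of `Ltilde`, so it is absorbed by `2 a b ≤ a² + b²`; this is the origin of the factor `2`.
-/
lemma sq_norm_le_Ltilde {L η : ℝ} (hL : 0 < L) {r k : ℕ} (hr : 1 ≤ r) {A₀ : Mat r k}
    (hA : ‖A₀‖ ≤ r + √((k : ℝ) * r)) :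
    (|η / r| * ‖A₀‖) ^ 2 * L ≤ 2 * Ltilde L η k r := by
  have hr' : (0 : ℝ) < r := by exact_mod_cast hr
  have h1 : ‖A₀‖ ^ 2 ≤ 2 * r ^ 2 * (1 + (k : ℝ) / r) := by
    have h2 : √((k : ℝ) * r) ^ 2 = k * r := Real.sq_sqrt (by positivity)
    have h3 : ‖A₀‖ ^ 2 ≤ (r + √((k : ℝ) * r)) ^ 2 := pow_le_pow_left₀ (norm_nonneg _) hA 2
    have h4 : 2 * (r : ℝ) ^ 2 * (1 + (k : ℝ) / r) = 2 * (r ^ 2 + k * r) := by field_simp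
    rw [h4]
    nlinarith [sq_nonneg ((r : ℝ) - √((k : ℝ) * r))]
  have h5 : (|η / r| * ‖A₀‖) ^ 2 * L ≤ 2 * (η ^ 2 * L * (1 + (k : ℝ) / r)) := by
    rw [mul_pow, sq_abs, div_pow]
    calc η ^ 2 / (r : ℝ) ^ 2 * ‖A₀‖ ^ 2 * L
        ≤ η ^ 2 / (r : ℝ) ^ 2 * (2 * r ^ 2 * (1 + (k : ℝ) / r)) * L := by gcongr
      _ = _ := by field_simp
  refine h5.trans ?_
  unfold Ltilde
  have : 0 ≤ 2 * √(k : ℝ) / (r : ℝ) ^ (3 / 2 : ℝ) := by positivity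
  refine mul_le_mul_of_nonneg_left (mul_le_mul_of_nonneg_left ?_ (by positivity)) zero_le_two
  linarith

/-- For `r ≤ k` the three summands are at most `k / r`, `k / r` and `2 k / r`. -/
lemma Ltilde_le {L η : ℝ} (hL : 0 < L) {r k : ℕ} (hr : 1 ≤ r) (hk : r ≤ k) :
    Ltilde L η k r ≤ 4 * η ^ 2 * L * (k / r) := by
  have hr' : (1 : ℝ) ≤ r := by exact_mod_cast hr
  have hk' : (1 : ℝ) ≤ k := by exact_mod_cast hr.trans hk
  have h1 := one_le_ratio hr hk
  have h2 : √(k : ℝ) ≤ k := Real.sqrt_le_self_iff.2 (Or.inr hk')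
  have h3 : (r : ℝ) ≤ (r : ℝ) ^ (3 / 2 : ℝ) := by
    conv_lhs => rw [← Real.rpow_one (r : ℝ)]
    exact Real.rpow_le_rpow_of_exponent_le hr' (by norm_num)
  have h4 : 2 * √(k : ℝ) / (r : ℝ) ^ (3 / 2 : ℝ) ≤ 2 * k / r := by gcongr
  unfold Ltilde
  calc η ^ 2 * L * (1 + (k : ℝ) / r + 2 * √(k : ℝ) / (r : ℝ) ^ (3 / 2 : ℝ))
      ≤ η ^ 2 * L * (k / r + (k : ℝ) / r + 2 * k / r) := by gcongr
    _ = _ := by ring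

end Lora

/-! ### The mixing matrix -/

section Mixing

variable {N : ℕ} {G : SimpleGraph (Fin N)} {M : Matrix (Fin N) (Fin N) ℝ} {ρ : ℝ}

/-- The all-ones vector is fixed by `M`, while all eigenvalues but the top one are less than `1` in
absolute value, so it is a multiple of the top eigenvector. A vector of sum zero thus has no top
component, and its other components shrink by `√ρ`. -/
lemma IsMixing.sum_sq_mulVec_le (h : IsMixing G M ρ) (hN : 1 ≤ N) (hρ : 0 < ρ) (hρ1 : ρ < 1)
    (x : Fin N → ℝ) (hx : ∑ i, x i = 0) : ∑ i, (M.mulVec x i) ^ 2 ≤ ρ * ∑ i, x i ^ 2 := by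
  set u := h.symm.eigenvectorBasis
  set ev := h.symm.eigenvalues with hev
  have hs1 : √ρ < 1 := by rw [Real.sqrt_lt' one_pos]; simpa
  -- The reindexing by which `eigenvalues` is defined from the sorted list `eigenvalues₀`; `i₀` is
  -- the index of the largest eigenvalue.
  set e := (Fintype.equivOfCardEq (Fintype.card_fin (Fintype.card (Fin N))) :
    Fin (Fintype.card (Fin N)) ≃ Fin N)
  set i₀ : Fin N := e ⟨0, by rw [Fintype.card_fin]; omega⟩
  have hsmall : ∀ l, l ≠ i₀ → |ev l| ≤ √ρ := by
    intro l hl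
    refine h.eig_le _ ?_
    rw [Nat.one_le_iff_ne_zero]
    intro h0
    apply hl
    have : e.symm l = ⟨0, by rw [Fintype.card_fin]; omega⟩ := Fin.ext h0
    exact (Equiv.symm_apply_eq e).1 this
  have hself : ∀ y z : EuclideanSpace ℝ (Fin N),
      inner ℝ y (WithLp.toLp 2 (M.mulVec z)) = inner ℝ (WithLp.toLp 2 (M.mulVec y)) z := by
    intro y z
    have := (Matrix.isSymmetric_toEuclideanLin_iff.mpr h.symm) y z
    exact this.symm
  have hcoef : ∀ l (z : EuclideanSpace ℝ (Fin N)),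
      inner ℝ (u l) (WithLp.toLp 2 (M.mulVec z)) = ev l * inner ℝ (u l) z := by
    intro l z
    rw [hself, h.symm.mulVec_eigenvectorBasis l, WithLp.toLp_smul, inner_smul_left]
    simp [u, ev]
  set one : EuclideanSpace ℝ (Fin N) := WithLp.toLp 2 1
  have hone : ∀ l, l ≠ i₀ → inner ℝ (u l) one = 0 := by
    intro l hl
    have h1 := hcoef l one
    have h2 : M.mulVec one = 1 := (mem_doublyStochastic.1 h.stochastic).2.1
    rw [h2] at h1
    have h3 : ev l ≠ 1 := by
      intro h3
      have := hsmall l hl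
      rw [h3] at this
      simp at this
      linarith
    have h4 : (1 - ev l) * inner ℝ (u l) one = 0 := by
      rw [sub_mul, one_mul, ← h1]; exact sub_self _
    rcases mul_eq_zero.1 h4 with h5 | h5
    · exact absurd (by linarith) h3
    · exact h5
  have hone0 : inner ℝ (u i₀) one ≠ 0 := by
    intro h0
    have h1 : one = 0 := by
      refine InnerProductSpace.ext_inner_left_basis u.toBasis fun l => ?_
      rw [inner_zero_right, OrthonormalBasis.coe_toBasis]
      by_cases hl : l = i₀
      · rw [hl]; exact h0
      · exact hone l hl
    have h2 : one i₀ = 0 := by rw [h1]; rfl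
    simp [one] at h2
  set X : EuclideanSpace ℝ (Fin N) := WithLp.toLp 2 x
  have hX0 : inner ℝ (u i₀) X = 0 := by
    have h1 : inner ℝ one X = 0 := by
      simp [one, X, PiLp.inner_apply, hx]
    rw [← u.sum_inner_mul_inner, Finset.sum_eq_single i₀] at h1
    · rcases mul_eq_zero.1 h1 with h2 | h2
      · rw [real_inner_comm] at h2; exact absurd h2 hone0
      · exact h2
    · intro l _ hl
      rw [real_inner_comm, hone l hl, zero_mul]
    · simp
  have hn : ∀ z : EuclideanSpace ℝ (Fin N), ∑ i, z i ^ 2 = ∑ l, (inner ℝ (u l) z) ^ 2 := by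
    intro z
    have h1 : ‖z‖ ^ 2 = ∑ i, z i ^ 2 := by rw [EuclideanSpace.norm_sq_eq]; simp
    rw [← h1, ← u.sum_sq_norm_inner_right z]
    simp
  have e1 := hn (WithLp.toLp 2 (M.mulVec X))
  have e2 := hn X
  simp only [X] at e1 e2
  rw [e1, e2, Finset.mul_sum]
  refine Finset.sum_le_sum fun l _ => ?_
  rw [hcoef l X, mul_pow]
  by_cases hl : l = i₀
  · rw [hl, hX0]; simp
  · have h1 : ev l ^ 2 ≤ ρ := by
      rw [← sq_abs, ← Real.sq_sqrt hρ.le]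
      exact pow_le_pow_left₀ (abs_nonneg _) (hsmall l hl) 2
    exact mul_le_mul_of_nonneg_right h1 (sq_nonneg _)

/-- A mixing matrix contracts families of vectors with average zero. -/
lemma IsMixing.sum_sq_norm_le (h : IsMixing G M ρ) (hN : 1 ≤ N) (hρ : 0 < ρ) (hρ1 : ρ < 1)
    {ι : Type*} [Fintype ι] (q : Fin N → EuclideanSpace ℝ ι) (hq : ∑ i, q i = 0) :
    ∑ i, ‖∑ j, M i j • q j‖ ^ 2 ≤ ρ * ∑ i, ‖q i‖ ^ 2 := by
  simp_rw [EuclideanSpace.norm_sq_eq, Real.norm_eq_abs, sq_abs]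
  rw [Finset.sum_comm, Finset.sum_comm (f := fun i p => q i p ^ 2), Finset.mul_sum]
  refine Finset.sum_le_sum fun p _ => ?_
  have h1 := h.sum_sq_mulVec_le hN hρ hρ1 (fun i => q i p) (by
    have := congrArg (fun v : EuclideanSpace ℝ ι => v p) hq
    simpa using this)
  simpa [Matrix.mulVec, dotProduct] using h1

end Mixing

/-! ### Averages -/

section Avg

variable {N d r : ℕ}

lemma avg_add (x y : Fin N → Mat d r) : avg (fun i => x i + y i) = avg x + avg y := by
  simp [avg, Finset.sum_add_distrib]

lemma avg_sub (x y : Fin N → Mat d r) : avg (fun i => x i - y i) = avg x - avg y := by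
  simp [avg, Finset.sum_sub_distrib, smul_sub]

lemma avg_smul (a : ℝ) (x : Fin N → Mat d r) : avg (fun i => a • x i) = a • avg x := by
  simp only [avg, ← Finset.smul_sum]
  rw [smul_comm]

lemma smul_avg (hN : 1 ≤ N) (x : Fin N → Mat d r) : (N : ℝ) • avg x = ∑ i, x i := by
  have : (N : ℝ) ≠ 0 := by positivity
  rw [avg, smul_smul, mul_one_div_cancel this, one_smul]

lemma sum_sub_avg (hN : 1 ≤ N) (x : Fin N → Mat d r) : ∑ i, (x i - avg x) = 0 := by
  rw [Finset.sum_sub_distrib, ← smul_avg hN x]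
  simp [← Nat.cast_smul_eq_nsmul ℝ]

lemma sum_norm_sq_sub_avg (hN : 1 ≤ N) (x : Fin N → Mat d r) :
    ∑ i, ‖x i - avg x‖ ^ 2 = ∑ i, ‖x i‖ ^ 2 - N * ‖avg x‖ ^ 2 := by
  simp_rw [norm_sub_sq_real, Finset.sum_add_distrib, Finset.sum_sub_distrib, ← Finset.mul_sum,
    ← sum_inner, ← smul_avg hN x, inner_smul_left, real_inner_self_eq_norm_sq]
  simp
  ring

lemma sum_norm_sq_sub_avg_le (hN : 1 ≤ N) (x : Fin N → Mat d r) :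
    ∑ i, ‖x i - avg x‖ ^ 2 ≤ ∑ i, ‖x i‖ ^ 2 := by
  rw [sum_norm_sq_sub_avg hN]
  linarith [mul_nonneg (Nat.cast_nonneg (α := ℝ) N) (sq_nonneg ‖avg x‖)]

/-- Nonnegativity of the variance. It also serves for averages over a mini-batch, with `N` the batch
size. -/
lemma norm_avg_sq_le (hN : 1 ≤ N) (x : Fin N → Mat d r) :
    ‖avg x‖ ^ 2 ≤ (1 / (N : ℝ)) * ∑ i, ‖x i‖ ^ 2 := by
  have h1 : 0 ≤ ∑ i, ‖x i - avg x‖ ^ 2 := by positivity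
  rw [sum_norm_sq_sub_avg hN] at h1
  have : (0 : ℝ) < N := by positivity
  rw [one_div, ← div_eq_inv_mul, le_div_iff₀ this]
  linarith

lemma norm_avg_le_of_forall_le (hN : 1 ≤ N) {x : Fin N → Mat d r} {a : ℝ} (h : ∀ i, ‖x i‖ ≤ a) :
    ‖avg x‖ ≤ a := by
  have hN' : (0 : ℝ) < N := by positivity
  rw [avg, norm_smul, Real.norm_of_nonneg (by positivity), one_div, ← div_eq_inv_mul,
    div_le_iff₀ hN']
  refine (norm_sum_le _ _).trans ((Finset.sum_le_sum fun i _ => h i).trans ?_)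
  simp [mul_comm]

lemma continuous_avg : Continuous (avg : (Fin N → Mat d r) → Mat d r) := by
  unfold avg; fun_prop

/-- The squared distance of a family to consensus. -/
noncomputable def dispersion (x : Fin N → Mat d r) : ℝ := ∑ i, ‖x i - avg x‖ ^ 2

end Avg

/-! ### One step of decentralized gradient descent -/

/-- Convexity of the square with weights `p`, `q`, `s`. Free weights are needed to keep a
contraction factor below `1`. -/
lemma norm_add_three_sq_le {E : Type*} [SeminormedAddCommGroup E] (a b c : E) {p q s : ℝ}
    (hp : 0 < p) (hq : 0 < q) (hs : 0 < s) (h : p + q + s = 1) :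
    ‖a + b + c‖ ^ 2 ≤ p⁻¹ * ‖a‖ ^ 2 + q⁻¹ * ‖b‖ ^ 2 + s⁻¹ * ‖c‖ ^ 2 := by
  have h1 : ‖a + b + c‖ ≤ ‖a‖ + ‖b‖ + ‖c‖ := norm_add₃_le
  refine (pow_le_pow_left₀ (norm_nonneg _) h1 2).trans ?_
  obtain ⟨A, hA⟩ : ∃ A, ‖a‖ = p * A := ⟨p⁻¹ * ‖a‖, by field_simp⟩
  obtain ⟨B, hB⟩ : ∃ B, ‖b‖ = q * B := ⟨q⁻¹ * ‖b‖, by field_simp⟩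
  obtain ⟨C, hC⟩ : ∃ C, ‖c‖ = s * C := ⟨s⁻¹ * ‖c‖, by field_simp⟩
  rw [hA, hB, hC]
  have e : ∀ {x : ℝ} (X : ℝ), 0 < x → x⁻¹ * (x * X) ^ 2 = x * X ^ 2 := by
    intro x X hx; field_simp
  rw [e A hp, e B hq, e C hs]
  obtain rfl : s = 1 - p - q := by linarith
  -- The gap in Jensen's inequality is the weighted variance `pq (A - B)² + ps (A - C)² + qs (B -
  -- C)²`.
  have h2 := mul_nonneg (mul_pos hp hq).le (sq_nonneg (A - B))
  have h3 := mul_nonneg (mul_pos hp hs).le (sq_nonneg (A - C))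
  have h4 := mul_nonneg (mul_pos hq hs).le (sq_nonneg (B - C))
  nlinarith

section Step

variable {N d r : ℕ} {G : SimpleGraph (Fin N)} {M : Matrix (Fin N) (Fin N) ℝ} {ρ : ℝ}

/-- One step of decentralized gradient descent with gradients `g` and gradient noise `n`. -/
noncomputable def gossipStep (M : Matrix (Fin N) (Fin N) ℝ) (α : ℝ)
    (g : Fin N → Mat d r → Mat d r) (x n : Fin N → Mat d r) (i : Fin N) : Mat d r :=
  ∑ j, M i j • x j - α • (g i (x i) + n i)

/-- The deviation from the average after a noiseless step. -/
noncomputable def drift (M : Matrix (Fin N) (Fin N) ℝ) (α : ℝ)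
    (g : Fin N → Mat d r → Mat d r) (x : Fin N → Mat d r) (i : Fin N) : Mat d r :=
  ∑ j, M i j • (x j - avg x) - α • (g i (x i) - avg fun j => g j (x j))

lemma IsMixing.row_sum (h : IsMixing G M ρ) (i : Fin N) : ∑ j, M i j = 1 :=
  (mem_doublyStochastic_iff_sum.1 h.stochastic).2.1 i

lemma IsMixing.col_sum (h : IsMixing G M ρ) (j : Fin N) : ∑ i, M i j = 1 :=
  (mem_doublyStochastic_iff_sum.1 h.stochastic).2.2 j

lemma IsMixing.sum_mix (h : IsMixing G M ρ) (x : Fin N → Mat d r) :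
    ∑ i, ∑ j, M i j • x j = ∑ j, x j := by
  rw [Finset.sum_comm]
  simp_rw [← Finset.sum_smul, h.col_sum, one_smul]

lemma IsMixing.avg_mix (h : IsMixing G M ρ) (x : Fin N → Mat d r) :
    avg (fun i => ∑ j, M i j • x j) = avg x := by
  rw [avg, h.sum_mix, avg]

lemma IsMixing.avg_gossipStep (h : IsMixing G M ρ) (α : ℝ) (g : Fin N → Mat d r → Mat d r)
    (x n : Fin N → Mat d r) :
    avg (gossipStep M α g x n) = avg x - α • (avg (fun i => g i (x i)) + avg n) := by
  unfold gossipStep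
  rw [avg_sub, h.avg_mix, avg_smul, avg_add]

lemma IsMixing.gossipStep_sub_avg (h : IsMixing G M ρ) (α : ℝ) (g : Fin N → Mat d r → Mat d r)
    (x n : Fin N → Mat d r) (i : Fin N) :
    gossipStep M α g x n i - avg (gossipStep M α g x n)
      = drift M α g x i - α • (n i - avg n) := by
  rw [h.avg_gossipStep]
  simp only [gossipStep, drift, smul_sub, smul_add, Finset.sum_sub_distrib, ← Finset.sum_smul,
    h.row_sum, one_smul]
  abel

lemma IsMixing.sum_drift (h : IsMixing G M ρ) (hN : 1 ≤ N) (α : ℝ)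
    (g : Fin N → Mat d r → Mat d r) (x : Fin N → Mat d r) : ∑ i, drift M α g x i = 0 := by
  simp only [drift]
  rw [Finset.sum_sub_distrib, h.sum_mix (fun j => x j - avg x), sum_sub_avg hN, ← Finset.smul_sum,
    sum_sub_avg hN (fun i => g i (x i))]
  simp

/-- The drift sums to zero, so the averaged noise drops out of the cross term; what remains there
has mean zero. Centering the noise only decreases its square sum. -/
lemma IsMixing.dispersion_gossipStep_le (h : IsMixing G M ρ) (hN : 1 ≤ N) (α : ℝ)
    (g : Fin N → Mat d r → Mat d r) (x n : Fin N → Mat d r) :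
    dispersion (gossipStep M α g x n) ≤ ∑ i, ‖drift M α g x i‖ ^ 2
      - 2 * α * ∑ i, inner ℝ (drift M α g x i) (n i) + α ^ 2 * ∑ i, ‖n i‖ ^ 2 := by
  simp only [dispersion, h.gossipStep_sub_avg]
  have h1 : ∑ i, inner ℝ (drift M α g x i) (n i - avg n)
      = ∑ i, inner ℝ (drift M α g x i) (n i) := by
    simp_rw [inner_sub_right, Finset.sum_sub_distrib]
    rw [← sum_inner, h.sum_drift hN, inner_zero_left, sub_zero]
  simp_rw [norm_sub_sq_real, Finset.sum_add_distrib, Finset.sum_sub_distrib, inner_smul_right,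
    norm_smul, mul_pow, Real.norm_eq_abs, sq_abs, ← Finset.mul_sum]
  rw [h1]
  have := mul_le_mul_of_nonneg_left (sum_norm_sq_sub_avg_le hN n) (sq_nonneg α)
  linarith

/-- The drift consists of the mixed deviations `a`, the change `b` of the local gradients between an
agent's point and the average, and the diversity `c` at the average. With `δ = 1 - √ρ` and weights
`√ρ`, `δ / 2`, `δ / 2`, the factor of the dispersion is `√ρ + (2 / δ) α² K² ≤ 1 - δ + δ / 4`. -/
lemma IsMixing.sum_norm_sq_drift_le (h : IsMixing G M ρ) (hN : 1 ≤ N) (hρ : 0 < ρ) (hρ1 : ρ < 1)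
    {α K κ : ℝ} {g : Fin N → Mat d r → Mat d r}
    (hg : ∀ i x y, ‖g i x - g i y‖ ≤ K * ‖x - y‖)
    (hκ : ∀ x, (1 / (N : ℝ)) * ∑ i, ‖g i x - avg (fun j => g j x)‖ ^ 2 ≤ κ ^ 2)
    (hα : α ^ 2 * K ^ 2 ≤ (1 - √ρ) ^ 2 / 8) (x : Fin N → Mat d r) :
    ∑ i, ‖drift M α g x i‖ ^ 2 ≤ (1 - 3 * (1 - √ρ) / 4) * dispersion x
      + 2 / (1 - √ρ) * (α ^ 2 * (N * κ ^ 2)) := by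
  have hs1 : √ρ < 1 := by rw [Real.sqrt_lt' one_pos]; simpa
  have hs0 : 0 < √ρ := Real.sqrt_pos.2 hρ
  set δ := 1 - √ρ with hδ
  have hδ0 : 0 < δ := by linarith
  have hN' : (0 : ℝ) < N := by positivity
  set b : Fin N → Mat d r := fun i => g i (x i) - g i (avg x)
  set a : Fin N → Mat d r := fun i => ∑ j, M i j • (x j - avg x)
  set c : Fin N → Mat d r := fun i => g i (avg x) - avg (fun j => g j (avg x))
  have hdec : ∀ i, drift M α g x i = a i + (-α) • (b i - avg b) + (-α) • c i := by
    intro i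
    simp only [drift, a, b, c, avg_sub]
    module
  have hJ : ∀ i, ‖drift M α g x i‖ ^ 2 ≤ (√ρ)⁻¹ * ‖a i‖ ^ 2
      + (δ / 2)⁻¹ * (α ^ 2 * ‖b i - avg b‖ ^ 2) + (δ / 2)⁻¹ * (α ^ 2 * ‖c i‖ ^ 2) := by
    intro i
    rw [hdec]
    have := norm_add_three_sq_le (a i) ((-α) • (b i - avg b)) ((-α) • c i) hs0
      (half_pos hδ0) (half_pos hδ0) (by rw [hδ]; ring)
    simpa [norm_smul, mul_pow] using this
  have ha : ∑ i, ‖a i‖ ^ 2 ≤ ρ * dispersion x :=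
    h.sum_sq_norm_le hN hρ hρ1 (fun j => x j - avg x) (sum_sub_avg hN x)
  have hb : ∑ i, ‖b i - avg b‖ ^ 2 ≤ K ^ 2 * dispersion x := by
    refine (sum_norm_sq_sub_avg_le hN b).trans ?_
    rw [dispersion, Finset.mul_sum]
    refine Finset.sum_le_sum fun i _ => ?_
    rw [← mul_pow]
    exact pow_le_pow_left₀ (norm_nonneg _) (hg i _ _) 2
  have hc : ∑ i, ‖c i‖ ^ 2 ≤ N * κ ^ 2 := by
    have := hκ (avg x)
    rw [one_div, ← div_eq_inv_mul, div_le_iff₀ hN'] at this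
    linarith
  have hq : 0 ≤ dispersion x := by unfold dispersion; positivity
  calc ∑ i, ‖drift M α g x i‖ ^ 2
      ≤ (√ρ)⁻¹ * ∑ i, ‖a i‖ ^ 2 + (δ / 2)⁻¹ * (α ^ 2 * ∑ i, ‖b i - avg b‖ ^ 2)
        + (δ / 2)⁻¹ * (α ^ 2 * ∑ i, ‖c i‖ ^ 2) := by
        refine (Finset.sum_le_sum fun i _ => hJ i).trans_eq ?_
        simp only [Finset.sum_add_distrib, Finset.mul_sum]
    _ ≤ (√ρ)⁻¹ * (ρ * dispersion x) + (δ / 2)⁻¹ * (α ^ 2 * (K ^ 2 * dispersion x))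
        + (δ / 2)⁻¹ * (α ^ 2 * (N * κ ^ 2)) := by gcongr
    _ = (√ρ + 2 / δ * (α ^ 2 * K ^ 2)) * dispersion x + 2 / δ * (α ^ 2 * (N * κ ^ 2)) := by
        have : (√ρ)⁻¹ * ρ = √ρ := by
          rw [inv_mul_eq_div, Real.div_sqrt]
        rw [← mul_assoc, this, inv_div]
        ring
    _ ≤ _ := by
        gcongr
        have h1 : 2 / δ * (α ^ 2 * K ^ 2) ≤ 2 / δ * (δ ^ 2 / 8) := by gcongr
        have h2 : 2 / δ * (δ ^ 2 / 8) = δ / 4 := by field_simp; norm_num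
        linarith

/-- The decrease of the objective at the average in one step. -/
lemma IsMixing.descent_gossipStep (h : IsMixing G M ρ) (hN : 1 ≤ N) {α K : ℝ} (hα0 : 0 < α)
    (hαK : α * K ≤ 1)
    {g : Fin N → Mat d r → Mat d r} (hg : ∀ i x y, ‖g i x - g i y‖ ≤ K * ‖x - y‖)
    {f : Mat d r → ℝ} (hf : Differentiable ℝ f)
    (hgrad : ∀ x, gradient f x = avg fun i => g i x) (x n : Fin N → Mat d r) :
    α / 2 * ‖gradient f (avg x)‖ ^ 2 ≤ f (avg x) - f (avg (gossipStep M α g x n))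
      + α / 2 * (K ^ 2 / N * dispersion x)
      - α * inner ℝ (gradient f (avg x) - (K * α) • avg (fun i => g i (x i))) (avg n)
      + K * α ^ 2 / 2 * ‖avg n‖ ^ 2 := by
  have hlip : ∀ y z, ‖gradient f y - gradient f z‖ ≤ K * ‖y - z‖ := by
    intro y z
    rw [hgrad, hgrad, ← avg_sub]
    exact norm_avg_le_of_forall_le hN fun i => hg i y z
  have h1 := descent_lemma hf hlip (avg x) (-(α • (avg (fun i => g i (x i)) + avg n)))
  rw [← sub_eq_add_neg, ← h.avg_gossipStep] at h1
  set u := gradient f (avg x)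
  set v := avg (fun i => g i (x i))
  set w := avg n
  have h2 : ‖u - v‖ ^ 2 ≤ K ^ 2 / N * dispersion x := by
    simp only [u, v]
    rw [hgrad, ← avg_sub]
    refine (norm_avg_sq_le hN _).trans ?_
    rw [dispersion, Finset.mul_sum, Finset.mul_sum]
    refine Finset.sum_le_sum fun i _ => ?_
    rw [one_div, div_eq_inv_mul, mul_assoc, ← mul_pow]
    gcongr
    rw [norm_sub_rev (x i)]
    exact hg i _ _
  -- Polarization: `-α ⟨u, v⟩ = -(α / 2) (‖u‖² + ‖v‖² - ‖u - v‖²)`.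
  have h3 : α / 2 * ‖u - v‖ ^ 2 ≤ α / 2 * (K ^ 2 / N * dispersion x) := by gcongr
  rw [norm_neg, norm_smul, mul_pow, Real.norm_eq_abs, sq_abs, inner_neg_right, inner_smul_right,
    inner_add_right, norm_add_sq_real] at h1
  rw [norm_sub_sq_real] at h3
  rw [inner_sub_left, inner_smul_left]
  simp only [conj_trivial]
  -- As `α K ≤ 1`, the second-order term in `v` is absorbed by the `-(α / 2) ‖v‖²` from the
  -- polarization.
  have h4 : K * α ^ 2 / 2 * ‖v‖ ^ 2 ≤ α / 2 * ‖v‖ ^ 2 := by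
    gcongr
    nlinarith
  linarith

end Step

/-! ### Decentralized stochastic gradient descent in expectation -/

section Expectation

variable {Ω : Type*} [MeasurableSpace Ω] {μ : Measure Ω}

lemma integrable_inner_of_memLp {E : Type*} [NormedAddCommGroup E] [InnerProductSpace ℝ E]
    {u v : Ω → E} (hu : MemLp u 2 μ) (hv : MemLp v 2 μ) :
    Integrable (fun ω => inner ℝ (u ω) (v ω)) μ := by
  have h1 := (hu.integrable_norm_pow two_ne_zero).add (hv.integrable_norm_pow two_ne_zero)
  refine h1.mono (hu.1.inner hv.1) (ae_of_all _ fun ω => ?_)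
  have h2 := norm_inner_le_norm (𝕜 := ℝ) (u ω) (v ω)
  refine h2.trans ?_
  rw [Pi.add_apply, Real.norm_of_nonneg (by positivity)]
  nlinarith [sq_nonneg (‖u ω‖ - ‖v ω‖), sq_nonneg ‖u ω‖, sq_nonneg ‖v ω‖]

lemma memLp_two_comp_of_lipschitz [IsFiniteMeasure μ] {E F : Type*} [NormedAddCommGroup E]
    [NormedAddCommGroup F] {g : E → F} {K : ℝ} (hg : ∀ x y, ‖g x - g y‖ ≤ K * ‖x - y‖)
    (hgc : Continuous g) {u : Ω → E} (hu : MemLp u 2 μ) : MemLp (fun ω => g (u ω)) 2 μ := by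
  have h1 : MemLp (fun ω => g (u ω) - g 0) 2 μ := by
    refine hu.of_le_mul (c := K) ?_ (ae_of_all _ fun ω => ?_)
    · exact (hgc.comp_aestronglyMeasurable hu.1).sub aestronglyMeasurable_const
    · simpa using hg (u ω) 0
  convert! h1.add (memLp_const (g 0)) using 1
  ext1 ω
  simp

variable {N d r : ℕ} {G : SimpleGraph (Fin N)} {M : Matrix (Fin N) (Fin N) ℝ} {ρ : ℝ}

lemma memLp_sum_smul {E : Type*} [NormedAddCommGroup E] [NormedSpace ℝ E] (a : Fin N → ℝ)
    {u : Fin N → Ω → E} (hu : ∀ i, MemLp (u i) 2 μ) :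
    MemLp (fun ω => ∑ i, a i • u i ω) 2 μ :=
  memLp_finsetSum Finset.univ (f := fun i ω => a i • u i ω) fun i _ => (hu i).const_smul (a i)

lemma memLp_avg {u : Ω → Fin N → Mat d r} (hu : ∀ i, MemLp (fun ω => u ω i) 2 μ) :
    MemLp (fun ω => avg (u ω)) 2 μ := by
  have h := memLp_sum_smul (fun _ => 1 / (N : ℝ)) hu
  simpa only [avg, Finset.smul_sum] using h

lemma memLp_sub_smul {E : Type*} [NormedAddCommGroup E] [NormedSpace ℝ E] (a : ℝ)
    {u v : Ω → E} (hu : MemLp u 2 μ) (hv : MemLp v 2 μ) :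
    MemLp (fun ω => u ω - a • v ω) 2 μ := hu.sub (hv.const_smul a)

/-- The gradient noise `n t` is square integrable with variance at most `ζ²` at every agent,
uncorrelated between agents and uncorrelated with functions of the current state `X t`. -/
structure UncorrelatedNoise (μ : Measure Ω) (X n : ℕ → Ω → Fin N → Mat d r) (ζ : ℝ) : Prop where
  memLp : ∀ t i, MemLp (fun ω => n t ω i) 2 μ
  var : ∀ t i, ∫ ω, ‖n t ω i‖ ^ 2 ∂μ ≤ ζ ^ 2
  orth : ∀ t i j, i ≠ j → ∫ ω, inner ℝ (n t ω i) (n t ω j) ∂μ = 0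
  orth_state : ∀ t i (v : (Fin N → Mat d r) → Mat d r), Continuous v →
    MemLp (fun ω => v (X t ω)) 2 μ → ∫ ω, inner ℝ (v (X t ω)) (n t ω i) ∂μ = 0

variable {X n : ℕ → Ω → Fin N → Mat d r} {ζ : ℝ}

/-- The cross terms vanish, leaving `N` variances divided by `N²`. -/
lemma UncorrelatedNoise.integral_norm_sq_avg_le (hn : UncorrelatedNoise μ X n ζ) (hN : 1 ≤ N)
    (t : ℕ) : ∫ ω, ‖avg (n t ω)‖ ^ 2 ∂μ ≤ ζ ^ 2 / N := by
  have hN' : (0 : ℝ) < N := by positivity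
  have h1 : ∀ ω, ‖avg (n t ω)‖ ^ 2
      = ((N : ℝ)⁻¹) ^ 2 * ∑ i, ∑ j, inner ℝ (n t ω i) (n t ω j) := by
    intro ω
    rw [avg, norm_smul, mul_pow, ← real_inner_self_eq_norm_sq (∑ i, n t ω i), sum_inner]
    simp [inner_sum]
  have hint : ∀ i j, Integrable (fun ω => inner ℝ (n t ω i) (n t ω j)) μ := fun i j =>
    integrable_inner_of_memLp (hn.memLp t i) (hn.memLp t j)
  simp_rw [h1]
  rw [integral_const_mul, integral_finsetSum _ fun i _ => integrable_finsetSum _ fun j _ =>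
    hint i j]
  have h2 : ∀ i, ∫ ω, ∑ j, inner ℝ (n t ω i) (n t ω j) ∂μ ≤ ζ ^ 2 := by
    intro i
    rw [integral_finsetSum _ fun j _ => hint i j, Finset.sum_eq_single i]
    · simp_rw [real_inner_self_eq_norm_sq]
      exact hn.var t i
    · exact fun j _ hj => hn.orth t i j hj.symm
    · simp
  calc ((N : ℝ)⁻¹) ^ 2 * ∑ i, ∫ ω, ∑ j, inner ℝ (n t ω i) (n t ω j) ∂μ
      ≤ ((N : ℝ)⁻¹) ^ 2 * ∑ i : Fin N, ζ ^ 2 := by gcongr with i; exact h2 i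
    _ = ζ ^ 2 / N := by simp; field_simp

lemma UncorrelatedNoise.integral_inner_avg (hn : UncorrelatedNoise μ X n ζ) (t : ℕ)
    {v : (Fin N → Mat d r) → Mat d r} (hv : Continuous v)
    (hv2 : MemLp (fun ω => v (X t ω)) 2 μ) :
    ∫ ω, inner ℝ (v (X t ω)) (avg (n t ω)) ∂μ = 0 := by
  simp_rw [avg, inner_smul_right, inner_sum]
  rw [integral_const_mul, integral_finsetSum _ fun i _ =>
    integrable_inner_of_memLp hv2 (hn.memLp t i)]
  simp [hn.orth_state t _ v hv hv2]

lemma continuous_of_norm_sub_le {E F : Type*} [NormedAddCommGroup E]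
    [NormedAddCommGroup F] {g : E → F} {K : ℝ} (hg : ∀ x y, ‖g x - g y‖ ≤ K * ‖x - y‖) :
    Continuous g := by
  refine (LipschitzWith.of_dist_le_mul (K := K.toNNReal) fun x y => ?_).continuous
  rw [dist_eq_norm, dist_eq_norm]
  exact (hg x y).trans (by gcongr; exact Real.le_coe_toNNReal K)

lemma integrable_dispersion {x : Ω → Fin N → Mat d r} (hx : ∀ i, MemLp (fun ω => x ω i) 2 μ) :
    Integrable (fun ω => dispersion (x ω)) μ := by
  unfold dispersion
  exact integrable_finsetSum _ fun i _ => ((hx i).sub (memLp_avg hx)).integrable_norm_pow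
    two_ne_zero

variable [IsProbabilityMeasure μ]

lemma memLp_state {α K : ℝ} {g : Fin N → Mat d r → Mat d r}
    (hg : ∀ i x y, ‖g i x - g i y‖ ≤ K * ‖x - y‖) {x₀ : Fin N → Mat d r}
    (hX0 : ∀ ω, X 0 ω = x₀) (hX : ∀ t ω, X (t + 1) ω = gossipStep M α g (X t ω) (n t ω))
    (hn : ∀ t i, MemLp (fun ω => n t ω i) 2 μ) (t : ℕ) : ∀ i, MemLp (fun ω => X t ω i) 2 μ := by
  induction t with
  | zero => intro i; simp_rw [hX0]; exact memLp_const _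
  | succ t ih =>
    intro i
    simp_rw [hX, gossipStep]
    have h1 := (memLp_two_comp_of_lipschitz (hg i) (continuous_of_norm_sub_le (hg i)) (ih i)).add
      (hn t i)
    exact memLp_sub_smul α (memLp_sum_smul (M i) ih) h1

/-- The expected deviation from consensus contracts up to the gradient diversity and the gradient
noise. -/
lemma IsMixing.integral_dispersion_succ_le (h : IsMixing G M ρ) (hN : 1 ≤ N) (hρ : 0 < ρ)
    (hρ1 : ρ < 1) {α K κ : ℝ} {g : Fin N → Mat d r → Mat d r}
    (hg : ∀ i x y, ‖g i x - g i y‖ ≤ K * ‖x - y‖)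
    (hκ : ∀ x, (1 / (N : ℝ)) * ∑ i, ‖g i x - avg (fun j => g j x)‖ ^ 2 ≤ κ ^ 2)
    (hα : α ^ 2 * K ^ 2 ≤ (1 - √ρ) ^ 2 / 8) {x₀ : Fin N → Mat d r}
    (hX0 : ∀ ω, X 0 ω = x₀) (hX : ∀ t ω, X (t + 1) ω = gossipStep M α g (X t ω) (n t ω))
    (hn : UncorrelatedNoise μ X n ζ) (t : ℕ) :
    ∫ ω, dispersion (X (t + 1) ω) ∂μ ≤ (1 - 3 * (1 - √ρ) / 4) * ∫ ω, dispersion (X t ω) ∂μ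
      + (2 / (1 - √ρ) * (α ^ 2 * (N * κ ^ 2)) + α ^ 2 * (N * ζ ^ 2)) := by
  have hXL := memLp_state hg hX0 hX hn.memLp
  have hgc := fun i => continuous_of_norm_sub_le (hg i)
  have hgL : ∀ i, MemLp (fun ω => g i (X t ω i)) 2 μ := fun i =>
    memLp_two_comp_of_lipschitz (hg i) (hgc i) (hXL t i)
  have hdL : ∀ i, MemLp (fun ω => drift M α g (X t ω) i) 2 μ := fun i =>
    memLp_sub_smul α (memLp_sum_smul (M i) fun j => (hXL t j).sub (memLp_avg (hXL t)))
      ((hgL i).sub (memLp_avg hgL))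
  have hdc : ∀ i, Continuous fun x : Fin N → Mat d r => drift M α g x i := by
    intro i
    have h1 := continuous_avg (N := N) (d := d) (r := r)
    have h2 : Continuous fun x : Fin N → Mat d r => avg fun j => g j (x j) :=
      h1.comp (continuous_pi fun j => (hgc j).comp (continuous_apply j))
    have h3 := (hgc i).comp (continuous_apply (A := fun _ : Fin N => Mat d r) i)
    unfold drift
    have h4 : Continuous fun x : Fin N → Mat d r => ∑ j, M i j • (x j - avg x) :=
      continuous_finsetSum _ fun j _ => ((continuous_apply j).sub h1).const_smul (M i j)
    exact h4.sub ((h3.sub h2).const_smul α)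
  have hin : ∀ i, Integrable (fun ω => inner ℝ (drift M α g (X t ω) i) (n t ω i)) μ := fun i =>
    integrable_inner_of_memLp (hdL i) (hn.memLp t i)
  have hnn : ∀ i, Integrable (fun ω => ‖n t ω i‖ ^ 2) μ := fun i =>
    (hn.memLp t i).integrable_norm_pow two_ne_zero
  have hpt : ∀ ω, dispersion (X (t + 1) ω) ≤ (1 - 3 * (1 - √ρ) / 4) * dispersion (X t ω)
      + 2 / (1 - √ρ) * (α ^ 2 * (N * κ ^ 2))
      - 2 * α * ∑ i, inner ℝ (drift M α g (X t ω) i) (n t ω i)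
      + α ^ 2 * ∑ i, ‖n t ω i‖ ^ 2 := by
    intro ω
    rw [hX]
    linarith [h.dispersion_gossipStep_le hN α g (X t ω) (n t ω),
      h.sum_norm_sq_drift_le hN hρ hρ1 hg hκ hα (X t ω)]
  have i1 := (integrable_dispersion (hXL t)).const_mul (1 - 3 * (1 - √ρ) / 4)
  have i2 : Integrable (fun _ : Ω => 2 / (1 - √ρ) * (α ^ 2 * (N * κ ^ 2))) μ := integrable_const _
  have i3 := (integrable_finsetSum Finset.univ fun i _ => hin i).const_mul (2 * α)
  have i4 := (integrable_finsetSum Finset.univ fun i _ => hnn i).const_mul (α ^ 2)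
  have i12 : Integrable (fun ω => (1 - 3 * (1 - √ρ) / 4) * dispersion (X t ω)
      + 2 / (1 - √ρ) * (α ^ 2 * (N * κ ^ 2))) μ := i1.add i2
  have i123 : Integrable (fun ω => (1 - 3 * (1 - √ρ) / 4) * dispersion (X t ω)
      + 2 / (1 - √ρ) * (α ^ 2 * (N * κ ^ 2))
      - 2 * α * ∑ i, inner ℝ (drift M α g (X t ω) i) (n t ω i)) μ := i12.sub i3
  refine (integral_mono (integrable_dispersion (hXL (t + 1))) (i123.add i4) hpt).trans ?_
  simp only [Pi.add_apply]
  rw [integral_add i123 i4, integral_sub i12 i3, integral_add i1 i2,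
    integral_const, integral_const_mul, integral_const_mul, integral_const_mul,
    integral_finsetSum _ fun i _ => hin i, integral_finsetSum _ fun i _ => hnn i]
  have h0 : ∑ i, ∫ ω, inner ℝ (drift M α g (X t ω) i) (n t ω i) ∂μ = 0 :=
    Finset.sum_eq_zero fun i _ => hn.orth_state t i _ (hdc i) (hdL i)
  have h5 : ∑ i, ∫ ω, ‖n t ω i‖ ^ 2 ∂μ ≤ N * ζ ^ 2 := by
    refine (Finset.sum_le_sum fun i _ => hn.var t i).trans_eq ?_
    simp
  have h6 := mul_le_mul_of_nonneg_left h5 (sq_nonneg α)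
  rw [h0]
  simp
  linarith

/-- The recursion reads `β a t ≤ a t - a (t + 1) + c`, which telescopes. -/
lemma sum_range_le_of_succ_le {a : ℕ → ℝ} {β c : ℝ} (ha : ∀ t, 0 ≤ a t)
    (h : ∀ t, a (t + 1) ≤ (1 - β) * a t + c) (T : ℕ) :
    β * ∑ t ∈ Finset.range T, a t ≤ a 0 + T * c := by
  suffices h' : β * ∑ t ∈ Finset.range T, a t ≤ a 0 - a T + T * c by linarith [ha T]
  induction T with
  | zero => simp
  | succ T ih =>
    rw [Finset.sum_range_succ, mul_add]
    push_cast
    linarith [h T]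

/-- Decentralized stochastic gradient descent on a smooth function: the expected squared gradient
at the average, summed over `T` steps. -/
theorem IsMixing.sum_integral_norm_sq_gradient_le (h : IsMixing G M ρ) (hN : 1 ≤ N) (hρ : 0 < ρ)
    (hρ1 : ρ < 1) {α K κ D R : ℝ} (hα0 : 0 < α) (hK : 0 < K) {g : Fin N → Mat d r → Mat d r}
    (hg : ∀ i x y, ‖g i x - g i y‖ ≤ K * ‖x - y‖)
    (hκ : ∀ x, (1 / (N : ℝ)) * ∑ i, ‖g i x - avg (fun j => g j x)‖ ^ 2 ≤ κ ^ 2)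
    (hα : α ^ 2 * K ^ 2 ≤ (1 - √ρ) ^ 2 / 8) {x₀ : Fin N → Mat d r}
    (hX0 : ∀ ω, X 0 ω = x₀) (hX : ∀ t ω, X (t + 1) ω = gossipStep M α g (X t ω) (n t ω))
    (hn : UncorrelatedNoise μ X n ζ)
    {f : Mat d r → ℝ} (hf : Differentiable ℝ f)
    (hgrad : ∀ x, gradient f x = avg fun i => g i x)
    (hD : ∀ x, f (avg x₀) - f x ≤ D) (hR : (1 / (N : ℝ)) * ∑ i, ‖x₀ i‖ ^ 2 ≤ R ^ 2) (T : ℕ) :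
    (∀ t, Integrable (fun ω => ‖gradient f (avg (X t ω))‖ ^ 2) μ) ∧
    ∑ t ∈ Finset.range T, ∫ ω, ‖gradient f (avg (X t ω))‖ ^ 2 ∂μ ≤
      2 * D / α + K ^ 2 * (4 / (3 * (1 - √ρ)))
        * (R ^ 2 + T * (2 / (1 - √ρ) * (α ^ 2 * κ ^ 2) + α ^ 2 * ζ ^ 2))
      + T * (K * α * ζ ^ 2 / N) := by
  have hs1 : √ρ < 1 := by rw [Real.sqrt_lt' one_pos]; simpa
  have hs0 : 0 < √ρ := Real.sqrt_pos.2 hρ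
  have hN' : (0 : ℝ) < N := by positivity
  have hXL := memLp_state hg hX0 hX hn.memLp
  have hgc := fun i => continuous_of_norm_sub_le (hg i)
  have hlip : ∀ y z, ‖gradient f y - gradient f z‖ ≤ K * ‖y - z‖ := by
    intro y z
    rw [hgrad, hgrad, ← avg_sub]
    exact norm_avg_le_of_forall_le hN fun i => hg i y z
  have hfc : Continuous (gradient f) := continuous_of_norm_sub_le hlip
  have hGL : ∀ t, MemLp (fun ω => gradient f (avg (X t ω))) 2 μ := fun t =>
    memLp_two_comp_of_lipschitz hlip hfc (memLp_avg (hXL t))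
  have hGi : ∀ t, Integrable (fun ω => ‖gradient f (avg (X t ω))‖ ^ 2) μ := fun t =>
    (hGL t).integrable_norm_pow two_ne_zero
  refine ⟨hGi, ?_⟩
  have hαK : α * K ≤ 1 := by
    have h1 : (α * K) ^ 2 ≤ 1 := by
      rw [mul_pow]; nlinarith
    nlinarith [mul_pos hα0 hK]
  set δ := 1 - √ρ with hδ
  have hδ0 : 0 < δ := by linarith
  set c := 2 / δ * (α ^ 2 * (N * κ ^ 2)) + α ^ 2 * (N * ζ ^ 2) with hc
  set q : ℕ → ℝ := fun t => ∫ ω, dispersion (X t ω) ∂μ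
  -- the total deviation from consensus
  have hq : 3 * δ / 4 * ∑ t ∈ Finset.range T, q t ≤ N * R ^ 2 + T * c := by
    have h1 := sum_range_le_of_succ_le (a := q) (β := 3 * δ / 4) (c := c)
      (fun t => integral_nonneg fun ω => by simp only [dispersion, Pi.zero_apply]; positivity)
      (fun t => h.integral_dispersion_succ_le hN hρ hρ1 hg hκ hα hX0 hX hn t) T
    have h2 : q 0 ≤ N * R ^ 2 := by
      simp only [q, hX0, integral_const, probReal_univ, one_smul]
      rw [one_div, ← div_eq_inv_mul, div_le_iff₀ hN'] at hR
      have := sum_norm_sq_sub_avg_le hN x₀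
      unfold dispersion
      linarith
    linarith
  -- the descent of the objective
  set V : (Fin N → Mat d r) → Mat d r := fun x =>
    gradient f (avg x) - (K * α) • avg (fun i => g i (x i))
  have hgm : Continuous fun x : Fin N → Mat d r => avg fun i => g i (x i) :=
    continuous_avg.comp (continuous_pi fun j => (hgc j).comp (continuous_apply j))
  have hVc : Continuous V := (hfc.comp continuous_avg).sub (hgm.const_smul (K * α))
  have hVL : ∀ t, MemLp (fun ω => V (X t ω)) 2 μ := fun t =>
    memLp_sub_smul (K * α) (hGL t) (memLp_avg fun i =>
      memLp_two_comp_of_lipschitz (hg i) (hgc i) (hXL t i))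
  have hnL : ∀ t, MemLp (fun ω => avg (n t ω)) 2 μ := fun t => memLp_avg (hn.memLp t)
  -- Telescoping before integrating bounds the objective differences by `D` pointwise, so
  -- integrability of the objective along the iterates is never needed.
  have hpt : ∀ ω, ∑ t ∈ Finset.range T, α / 2 * ‖gradient f (avg (X t ω))‖ ^ 2 ≤ D
      + ∑ t ∈ Finset.range T, (α / 2 * (K ^ 2 / N) * dispersion (X t ω)
        - α * inner ℝ (V (X t ω)) (avg (n t ω)) + K * α ^ 2 / 2 * ‖avg (n t ω)‖ ^ 2) := by
    intro ω
    have h1 : ∀ t, α / 2 * ‖gradient f (avg (X t ω))‖ ^ 2 ≤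
        (f (avg (X t ω)) - f (avg (X (t + 1) ω))) + (α / 2 * (K ^ 2 / N) * dispersion (X t ω)
        - α * inner ℝ (V (X t ω)) (avg (n t ω)) + K * α ^ 2 / 2 * ‖avg (n t ω)‖ ^ 2) := by
      intro t
      have := h.descent_gossipStep hN hα0 hαK hg hf hgrad (X t ω) (n t ω)
      rw [hX]
      simp only [V]
      linarith
    refine (Finset.sum_le_sum fun t _ => h1 t).trans ?_
    rw [Finset.sum_add_distrib, Finset.sum_range_sub' (fun t => f (avg (X t ω))), hX0 ω]
    gcongr
    exact hD _
  have i1 : ∀ t, Integrable (fun ω => α / 2 * (K ^ 2 / N) * dispersion (X t ω)) μ := fun t =>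
    (integrable_dispersion (hXL t)).const_mul _
  have i2 : ∀ t, Integrable (fun ω => α * inner ℝ (V (X t ω)) (avg (n t ω))) μ := fun t =>
    (integrable_inner_of_memLp (hVL t) (hnL t)).const_mul _
  have i3 : ∀ t, Integrable (fun ω => K * α ^ 2 / 2 * ‖avg (n t ω)‖ ^ 2) μ := fun t =>
    ((hnL t).integrable_norm_pow two_ne_zero).const_mul _
  have i4 : ∀ t, Integrable (fun ω => α / 2 * (K ^ 2 / N) * dispersion (X t ω)
      - α * inner ℝ (V (X t ω)) (avg (n t ω)) + K * α ^ 2 / 2 * ‖avg (n t ω)‖ ^ 2) μ := fun t =>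
    ((i1 t).sub (i2 t)).add (i3 t)
  have hI := integral_mono (integrable_finsetSum _ fun t _ => (hGi t).const_mul (α / 2))
    ((integrable_const D).add (integrable_finsetSum (Finset.range T) fun t _ => i4 t)) hpt
  simp only [Pi.add_apply] at hI
  rw [integral_finsetSum _ fun t _ => (hGi t).const_mul (α / 2),
    integral_add (integrable_const D) (integrable_finsetSum (Finset.range T) fun t _ => i4 t),
    integral_finsetSum _ fun t _ => i4 t, integral_const, probReal_univ, one_smul] at hI
  have hstep : ∀ t, ∫ ω, (α / 2 * (K ^ 2 / N) * dispersion (X t ω)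
      - α * inner ℝ (V (X t ω)) (avg (n t ω)) + K * α ^ 2 / 2 * ‖avg (n t ω)‖ ^ 2) ∂μ
      ≤ α / 2 * (K ^ 2 / N) * q t + K * α ^ 2 / 2 * (ζ ^ 2 / N) := by
    intro t
    have i12 : Integrable (fun ω => α / 2 * (K ^ 2 / N) * dispersion (X t ω)
      - α * inner ℝ (V (X t ω)) (avg (n t ω))) μ := (i1 t).sub (i2 t)
    rw [integral_add i12 (i3 t), integral_sub (i1 t) (i2 t), integral_const_mul,
      integral_const_mul, integral_const_mul, hn.integral_inner_avg t hVc (hVL t), mul_zero,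
      sub_zero]
    gcongr
    exact hn.integral_norm_sq_avg_le hN t
  have hI2 := hI.trans (add_le_add le_rfl (Finset.sum_le_sum fun t _ => hstep t))
  simp_rw [integral_const_mul] at hI2
  rw [Finset.sum_add_distrib, ← Finset.mul_sum, ← Finset.mul_sum, Finset.sum_const,
    Finset.card_range, nsmul_eq_mul] at hI2
  set S := ∑ t ∈ Finset.range T, ∫ ω, ‖gradient f (avg (X t ω))‖ ^ 2 ∂μ
  set Q := ∑ t ∈ Finset.range T, q t
  have hQ : K ^ 2 / N * Q ≤ K ^ 2 * (4 / (3 * δ))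
        * (R ^ 2 + T * (2 / δ * (α ^ 2 * κ ^ 2) + α ^ 2 * ζ ^ 2)) := by
    have h1 : Q ≤ 4 / (3 * δ) * (N * R ^ 2 + T * c) := by
      rw [div_mul_eq_mul_div, le_div_iff₀ (by positivity)]
      linarith
    refine (mul_le_mul_of_nonneg_left h1 (by positivity)).trans_eq ?_
    rw [hc]
    field_simp
  have hfin : S ≤ 2 / α * (D + (α / 2 * (K ^ 2 / N) * Q + T * (K * α ^ 2 / 2 * (ζ ^ 2 / N)))) := by
    rw [div_mul_eq_mul_div, le_div_iff₀ hα0]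
    linarith
  refine hfin.trans ?_
  have e1 : 2 / α * (D + (α / 2 * (K ^ 2 / N) * Q + T * (K * α ^ 2 / 2 * (ζ ^ 2 / N))))
      = 2 * D / α + K ^ 2 / N * Q + T * (K * α * ζ ^ 2 / N) := by
    field_simp
    ring
  rw [e1]
  gcongr

end Expectation

/-! ### Centered functions of an independent sample -/

/-- A bound on the Lebesgue integral includes integrability. A bound on the Bochner integral would
not, its default value being `0`. -/
lemma memLp_two_of_lintegral_le {Ω E : Type*} [MeasurableSpace Ω] {μ : Measure Ω}
    [NormedAddCommGroup E] [MeasurableSpace E] [BorelSpace E] [SecondCountableTopology E] {f : Ω → E} (hf : Measurable f) {c : ℝ}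
    (h : ∫⁻ ω, ENNReal.ofReal (‖f ω‖ ^ 2) ∂μ ≤ ENNReal.ofReal c) : MemLp f 2 μ := by
  rw [memLp_two_iff_integrable_sq_norm hf.aestronglyMeasurable]
  refine ⟨(hf.norm.pow_const 2).aestronglyMeasurable, ?_⟩
  rw [hasFiniteIntegral_iff_ofReal (ae_of_all _ fun ω => by simp only [Pi.zero_apply]; positivity)]
  exact h.trans_lt ENNReal.ofReal_lt_top

lemma integral_norm_sq_le_of_lintegral_le {Ω E : Type*} [MeasurableSpace Ω] {μ : Measure Ω}
    [NormedAddCommGroup E] [MeasurableSpace E] [BorelSpace E] {f : Ω → E} (hf : Measurable f) {c : ℝ} (hc : 0 ≤ c)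
    (h : ∫⁻ ω, ENNReal.ofReal (‖f ω‖ ^ 2) ∂μ ≤ ENNReal.ofReal c) :
    ∫ ω, ‖f ω‖ ^ 2 ∂μ ≤ c := by
  rw [integral_eq_lintegral_of_nonneg_ae (ae_of_all _ fun ω => by
    simp only [Pi.zero_apply]; positivity) (hf.norm.pow_const 2).aestronglyMeasurable]
  exact ENNReal.toReal_le_of_le_ofReal hc h

section Independence

variable {Ω α β E : Type*} [MeasurableSpace Ω] [MeasurableSpace α] [MeasurableSpace β]
  {μ : Measure Ω} [IsProbabilityMeasure μ] {X : Ω → α} {Y : Ω → β}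
  [NormedAddCommGroup E] [InnerProductSpace ℝ E] [CompleteSpace E] [MeasurableSpace E]
  [BorelSpace E] [SecondCountableTopology E]

/-- The joint law is a product, so by Tonelli a bound uniform in the frozen value of `X` suffices.
-/
lemma lintegral_comp_le_of_indepFun (hX : Measurable X) (hY : Measurable Y)
    (hXY : IndepFun X Y μ) {F : α × β → ENNReal} (hF : Measurable F) {c : ENNReal}
    (hc : ∀ x, ∫⁻ y, F (x, y) ∂(μ.map Y) ≤ c) : ∫⁻ ω, F (X ω, Y ω) ∂μ ≤ c := by
  have h1 := (indepFun_iff_map_prod_eq_prod_map_map hX.aemeasurable hY.aemeasurable).1 hXY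
  have : IsProbabilityMeasure (μ.map X) := Measure.isProbabilityMeasure_map hX.aemeasurable
  have : IsProbabilityMeasure (μ.map Y) := Measure.isProbabilityMeasure_map hY.aemeasurable
  rw [← lintegral_map (f := F) hF (hX.prodMk hY), h1, lintegral_prod _ hF.aemeasurable]
  refine (lintegral_mono fun x => hc x).trans ?_
  simp

/-- Fubini on the product law takes the place of conditioning on `X`: for frozen `X` the first
factor is constant and the second has mean zero. -/
lemma integral_inner_comp_eq_zero_of_indepFun (hX : Measurable X) (hY : Measurable Y)
    (hXY : IndepFun X Y μ) {φ : α × β → E} (hφ : Measurable φ) {u : α → E} (hu : Measurable u)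
    (hint : ∀ x, Integrable (fun y => φ (x, y)) (μ.map Y))
    (hzero : ∀ x, ∫ y, φ (x, y) ∂(μ.map Y) = 0)
    (hu2 : MemLp (fun ω => u (X ω)) 2 μ) (hφ2 : MemLp (fun ω => φ (X ω, Y ω)) 2 μ) :
    ∫ ω, inner ℝ (u (X ω)) (φ (X ω, Y ω)) ∂μ = 0 := by
  have h1 := (indepFun_iff_map_prod_eq_prod_map_map hX.aemeasurable hY.aemeasurable).1 hXY
  have : IsProbabilityMeasure (μ.map X) := Measure.isProbabilityMeasure_map hX.aemeasurable
  have : IsProbabilityMeasure (μ.map Y) := Measure.isProbabilityMeasure_map hY.aemeasurable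
  have hm : Measurable fun p : α × β => inner ℝ (u p.1) (φ p) := (hu.comp measurable_fst).inner hφ
  have h2 : Integrable (fun p : α × β => inner ℝ (u p.1) (φ p)) (μ.map fun ω => (X ω, Y ω)) := by
    rw [integrable_map_measure hm.aestronglyMeasurable (hX.prodMk hY).aemeasurable]
    exact integrable_inner_of_memLp hu2 hφ2
  rw [← integral_map (f := fun p : α × β => inner ℝ (u p.1) (φ p)) (hX.prodMk hY).aemeasurable
    hm.aestronglyMeasurable, h1]
  rw [h1] at h2
  rw [integral_prod _ h2]
  simp [integral_inner (hint _), hzero]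

end Independence

/-! ### The stochastic gradients -/

section Task

variable {N d k r : ℕ} {Z : Type*} [MeasurableSpace Z] {P : Task N d k Z} {η : ℝ} {A₀ : Mat r k}
  {ζ : ℝ}

lemma Task.WellPosed.measurable_sampleGrad (hP : P.WellPosed η A₀) (i : Fin N) :
    Measurable fun p : Mat d r × Z => P.sampleGrad η A₀ i p.1 p.2 := by
  refine measurable_gradient_uncurry (φ := fun (B : Mat d r) z => P.F i (lora η P.W₀ A₀ B) z) ?_ ?_
  · intro z
    have h : Differentiable ℝ fun B : Mat d r => lora η P.W₀ A₀ B := by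
      simp_rw [lora_eq]
      exact (loraLin d η A₀).differentiable.const_add _
    exact (hP.diff i z).comp h
  · exact fun B => hP.meas i _

/-- The error of the stochastic gradient of agent `i` over a mini-batch. -/
noncomputable def batchNoise (P : Task N d k Z) (η : ℝ) (A₀ : Mat r k) (i : Fin N) {b : ℕ}
    (p : Mat d r × (Fin b → Z)) : Mat d r :=
  P.batchGrad η A₀ i p.2 p.1 - gradient (P.fB η A₀ i) p.1

lemma Task.WellPosed.measurable_batchGrad (hP : P.WellPosed η A₀) (i : Fin N) (b : ℕ) :
    Measurable fun p : Mat d r × (Fin b → Z) => P.batchGrad η A₀ i p.2 p.1 := by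
  have h : Measurable fun p : Mat d r × (Fin b → Z) => ∑ s, P.sampleGrad η A₀ i p.1 (p.2 s) :=
    Finset.measurable_fun_sum _ fun s _ => (hP.measurable_sampleGrad i).comp
      (g := fun q : Mat d r × Z => P.sampleGrad η A₀ i q.1 q.2)
      (f := fun p : Mat d r × (Fin b → Z) => (p.1, p.2 s)) (by fun_prop)
  exact h.const_smul (1 / (b : ℝ))

lemma batchNoise_eq (i : Fin N) {b : ℕ} (hb : 0 < b) (x : Mat d r) (S : Fin b → Z) :
    batchNoise P η A₀ i (x, S)
      = (1 / (b : ℝ)) • ∑ s, (P.sampleGrad η A₀ i x (S s) - gradient (P.fB η A₀ i) x) := by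
  have hb' : (b : ℝ) ≠ 0 := by positivity
  rw [batchNoise, Task.batchGrad, Finset.sum_sub_distrib, smul_sub, Finset.sum_const,
    Finset.card_univ, Fintype.card_fin, ← Nat.cast_smul_eq_nsmul ℝ, smul_smul,
    one_div_mul_cancel hb', one_smul]

/-- Only convexity is used: the elements of one batch need not be independent, so no factor `1 / b`
is gained in the variance. -/
lemma norm_sq_batchNoise_le (i : Fin N) {b : ℕ} (hb : 0 < b) (x : Mat d r) (S : Fin b → Z) :
    ‖batchNoise P η A₀ i (x, S)‖ ^ 2 ≤ (1 / (b : ℝ)) *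
      ∑ s, ‖P.sampleGrad η A₀ i x (S s) - gradient (P.fB η A₀ i) x‖ ^ 2 := by
  rw [batchNoise_eq i hb]
  exact norm_avg_sq_le hb fun s => P.sampleGrad η A₀ i x (S s) - gradient (P.fB η A₀ i) x

variable {b : ℕ} {i : Fin N} {τ : Measure (Fin b → Z)}

lemma lintegral_norm_sq_batchNoise_le (hP : P.WellPosed η A₀) (hV : P.BoundedVariance η A₀ ζ)
    (hb : 0 < b) (hτ : ∀ s, τ.map (fun S => S s) = P.dist i) (x : Mat d r) :
    ∫⁻ S, ENNReal.ofReal (‖batchNoise P η A₀ i (x, S)‖ ^ 2) ∂τ ≤ ENNReal.ofReal (ζ ^ 2) := by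
  set e : Z → ℝ := fun z => ‖P.sampleGrad η A₀ i x z - gradient (P.fB η A₀ i) x‖ ^ 2 with he
  have hem : Measurable fun z => ENNReal.ofReal (e z) :=
    ((((hP.measurable_sampleGrad i).comp measurable_prodMk_left).sub_const _).norm.pow_const
      2).ennreal_ofReal
  have hem' : ∀ s, Measurable fun S : Fin b → Z => ENNReal.ofReal (e (S s)) := fun s =>
    hem.comp (measurable_pi_apply s)
  have hb' : (b : ℝ) ≠ 0 := by positivity
  calc ∫⁻ S, ENNReal.ofReal (‖batchNoise P η A₀ i (x, S)‖ ^ 2) ∂τ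
      ≤ ∫⁻ S, ENNReal.ofReal (1 / (b : ℝ)) * ∑ s, ENNReal.ofReal (e (S s)) ∂τ := by
        refine lintegral_mono fun S => ?_
        rw [← ENNReal.ofReal_sum_of_nonneg fun s _ => by simp only [he]; positivity,
          ← ENNReal.ofReal_mul (by positivity)]
        exact ENNReal.ofReal_le_ofReal (norm_sq_batchNoise_le i hb x S)
    _ = ENNReal.ofReal (1 / (b : ℝ)) * ∑ s, ∫⁻ S, ENNReal.ofReal (e (S s)) ∂τ := by
        rw [lintegral_const_mul _ (Finset.measurable_fun_sum _ fun s _ => hem' s),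
          lintegral_finsetSum _ fun s _ => hem' s]
    _ ≤ ENNReal.ofReal (1 / (b : ℝ)) * ∑ s : Fin b, ENNReal.ofReal (ζ ^ 2) := by
        gcongr with s
        rw [← lintegral_map (f := fun z => ENNReal.ofReal (e z)) hem (measurable_pi_apply s), hτ]
        exact hV i x
    _ = ENNReal.ofReal (ζ ^ 2) := by
        rw [Finset.sum_const, Finset.card_univ, Fintype.card_fin, nsmul_eq_mul, ← mul_assoc,
          ← ENNReal.ofReal_natCast, ← ENNReal.ofReal_mul (by positivity),
          one_div_mul_cancel hb', ENNReal.ofReal_one, one_mul]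

lemma integrable_sampleGrad (hP : P.WellPosed η A₀) (hV : P.BoundedVariance η A₀ ζ) (i : Fin N)
    (x : Mat d r) : Integrable (fun z => P.sampleGrad η A₀ i x z) (P.dist i) := by
  have := hP.prob i
  have h1 : Measurable fun z => P.sampleGrad η A₀ i x z :=
    (hP.measurable_sampleGrad i).comp measurable_prodMk_left
  have h2 := (memLp_two_of_lintegral_le (h1.sub_const _) (hV i x)).integrable one_le_two
  convert! h2.add (integrable_const (gradient (P.fB η A₀ i) x)) using 1
  ext1 z
  simp

lemma integrable_sampleGrad_comp (hP : P.WellPosed η A₀) (hV : P.BoundedVariance η A₀ ζ)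
    (hτ : ∀ s, τ.map (fun S => S s) = P.dist i) (x : Mat d r) (s : Fin b) :
    Integrable (fun S => P.sampleGrad η A₀ i x (S s)) τ := by
  have h := integrable_sampleGrad hP hV i x
  rw [← hτ s] at h
  exact h.comp_measurable (measurable_pi_apply s)

lemma integrable_batchNoise [IsProbabilityMeasure τ] (hP : P.WellPosed η A₀)
    (hV : P.BoundedVariance η A₀ ζ)
    (hτ : ∀ s, τ.map (fun S => S s) = P.dist i) (x : Mat d r) :
    Integrable (fun S => batchNoise P η A₀ i (x, S)) τ := by
  have h := (integrable_finsetSum Finset.univ fun s _ =>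
    integrable_sampleGrad_comp hP hV hτ x s).smul (1 / (b : ℝ))
  exact h.sub (integrable_const (gradient (P.fB η A₀ i) x))

lemma integral_batchNoise [IsProbabilityMeasure τ] (hP : P.WellPosed η A₀)
    (hV : P.BoundedVariance η A₀ ζ) (hb : 0 < b)
    (hτ : ∀ s, τ.map (fun S => S s) = P.dist i) (x : Mat d r) :
    ∫ S, batchNoise P η A₀ i (x, S) ∂τ = 0 := by
  have hint : ∀ s, Integrable (fun S : Fin b → Z =>
      P.sampleGrad η A₀ i x (S s) - gradient (P.fB η A₀ i) x) τ := fun s =>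
    (integrable_sampleGrad_comp hP hV hτ x s).sub (integrable_const _)
  simp_rw [batchNoise_eq i hb]
  rw [integral_smul, integral_finsetSum _ fun s _ => hint s]
  refine smul_eq_zero_of_right _ (Finset.sum_eq_zero fun s _ => ?_)
  rw [integral_sub (integrable_sampleGrad_comp hP hV hτ x s) (integrable_const _), integral_const,
    probReal_univ, one_smul, ← hP.unbiased i x, ← hτ s,
    integral_map (measurable_pi_apply s).aemeasurable, sub_self]
  rw [hτ s]
  exact (integrable_sampleGrad hP hV i x).1

end Task

/-! ### The noise of the iterates -/

section Iterates

variable {N d k r : ℕ} {Z : Type*} [MeasurableSpace Z] {P : Task N d k Z} {η : ℝ} {A₀ : Mat r k}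
  {G : SimpleGraph (Fin N)} {M : Matrix (Fin N) (Fin N) ℝ} {ρ α ζ K : ℝ} {b : Fin N → ℕ}
  {B₁ : Fin N → Mat d r}

/-- Only batches of steps before `t` enter, and the σ-algebra on `Ω` is arbitrary, so that
`otherBatches` can be inserted. -/
lemma measurable_iterates (hP : P.WellPosed η A₀) {Ω : Type*} [mΩ : MeasurableSpace Ω]
    {S : ℕ → (i : Fin N) → Ω → Fin (b i) → Z} (t : ℕ) (hS : ∀ s < t, ∀ i, Measurable (S s i)) :
    ∀ i, Measurable fun ω => iterates P η A₀ G M α B₁ (fun s i => S s i ω) t i := by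
  induction t with
  | zero => intro i; exact measurable_const
  | succ t ih =>
    have ih' := ih fun s hs => hS s (hs.trans t.lt_succ_self)
    intro i
    simp only [iterates]
    have h1 : Measurable fun ω => P.batchGrad η A₀ i (S t i ω)
        (iterates P η A₀ G M α B₁ (fun s i => S s i ω) t i) :=
      (hP.measurable_batchGrad i (b i)).comp
        (f := fun ω => (iterates P η A₀ G M α B₁ (fun s i => S s i ω) t i, S t i ω))
        ((ih' i).prodMk (hS t t.lt_succ_self i))
    have h2 : Measurable fun ω => ∑ j ∈ Nb G i,
        M i j • iterates P η A₀ G M α B₁ (fun s i => S s i ω) t j :=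
      Finset.measurable_fun_sum _ fun j _ => (ih' j).const_smul (M i j)
    have h3 : Measurable fun ω => α • P.batchGrad η A₀ i (S t i ω)
        (iterates P η A₀ G M α B₁ (fun s i => S s i ω) t i) := h1.const_smul α
    exact h2.sub h3

lemma iterates_succ_eq_gossipStep (hM : IsMixing G M ρ) (S : ℕ → (i : Fin N) → Fin (b i) → Z)
    (t : ℕ) : iterates P η A₀ G M α B₁ S (t + 1)
      = gossipStep M α (fun i => gradient (P.fB η A₀ i)) (iterates P η A₀ G M α B₁ S t)
        (fun i => batchNoise P η A₀ i (iterates P η A₀ G M α B₁ S t i, S t i)) := by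
  ext1 i
  have h : ∑ j ∈ Nb G i, M i j • iterates P η A₀ G M α B₁ S t j
      = ∑ j, M i j • iterates P η A₀ G M α B₁ S t j := by
    refine Finset.sum_subset (Finset.subset_univ _) fun j _ hj => ?_
    rw [hM.support i j hj, zero_smul]
  have hs : iterates P η A₀ G M α B₁ S (t + 1) i
      = ∑ j ∈ Nb G i, M i j • iterates P η A₀ G M α B₁ S t j
        - α • P.batchGrad η A₀ i (S t i) (iterates P η A₀ G M α B₁ S t i) := rfl
  rw [hs, gossipStep, h, batchNoise, add_sub_cancel]

variable {Ω : Type*} {ξ : ℕ → (i : Fin N) → Ω → Fin (b i) → Z}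

/-- The events that depend on all mini-batches but the one of agent `i` at step `t`. -/
abbrev otherBatches (ξ : ℕ → (i : Fin N) → Ω → Fin (b i) → Z) (t : ℕ) (i : Fin N) :
    MeasurableSpace Ω :=
  ⨆ p ∈ ({(t, i)}ᶜ : Set (ℕ × Fin N)), MeasurableSpace.comap (ξ p.1 p.2) inferInstance

lemma measurable_otherBatches {t : ℕ} {i : Fin N} {s : ℕ} {j : Fin N} (h : (s, j) ≠ (t, i)) :
    Measurable[otherBatches ξ t i] (ξ s j) := by
  rw [measurable_iff_comap_le]
  exact le_iSup₂_of_le (s, j) h le_rfl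

variable [mΩ : MeasurableSpace Ω] {μ : Measure Ω}

lemma IsSampling.otherBatches_le (hS : IsSampling μ P.dist b ξ) (t : ℕ) (i : Fin N) :
    otherBatches ξ t i ≤ mΩ :=
  iSup₂_le fun p _ => (hS.meas p.1 p.2).comap_le

lemma IsSampling.indepFun (hS : IsSampling μ P.dist b ξ) {t : ℕ} {i : Fin N} {γ : Type*}
    [MeasurableSpace γ] {u : Ω → γ} (hu : Measurable[otherBatches ξ t i] u) :
    IndepFun u (ξ t i) μ := by
  have h := indep_iSup_of_disjoint (fun p : ℕ × Fin N => (hS.meas p.1 p.2).comap_le) hS.indep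
    (S := {(t, i)}ᶜ) (T := {(t, i)}) disjoint_compl_left
  rw [iSup_singleton] at h
  rw [IndepFun_iff_Indep]
  exact indep_of_indep_of_le_left h hu.comap_le

/-- Both orthogonality relations are instances of `horth`: the state at step `t`, and the noise of
any other agent at step `t`, are functions of batches other than the one in question. -/
lemma uncorrelatedNoise_iterates [IsProbabilityMeasure μ] (hP : P.WellPosed η A₀) (hV : P.BoundedVariance η A₀ ζ)
    (hg : ∀ i, Continuous (gradient (P.fB η A₀ i) : Mat d r → Mat d r))
    (hS : IsSampling μ P.dist b ξ) :
    UncorrelatedNoise μ (fun t ω => iterates P η A₀ G M α B₁ (fun s i => ξ s i ω) t)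
      (fun t ω i => batchNoise P η A₀ i
        (iterates P η A₀ G M α B₁ (fun s i => ξ s i ω) t i, ξ t i ω)) ζ := by
  set X : ℕ → Ω → Fin N → Mat d r := fun t ω => iterates P η A₀ G M α B₁ (fun s i => ξ s i ω) t
  have hXm : ∀ t i j, Measurable[otherBatches ξ t i] fun ω => X t ω j := fun t i =>
    measurable_iterates (mΩ := otherBatches ξ t i) hP t fun s hs j =>
      measurable_otherBatches fun h => hs.ne (congrArg Prod.fst h)
  have hXm' : ∀ t i j, Measurable fun ω => X t ω j := fun t i j =>
    (hXm t i j).mono (hS.otherBatches_le t i) le_rfl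
  have hφ : ∀ i, Measurable fun p : Mat d r × (Fin (b i) → Z) => batchNoise P η A₀ i p := fun i =>
    (hP.measurable_batchGrad i (b i)).sub ((hg i).measurable.comp measurable_fst)
  have hτ : ∀ t i s, (μ.map (ξ t i)).map (fun S => S s) = P.dist i := by
    intro t i s
    rw [Measure.map_map (measurable_pi_apply s) (hS.meas t i)]
    exact hS.law t i s
  have hτp : ∀ t i, IsProbabilityMeasure (μ.map (ξ t i)) := fun t i =>
    Measure.isProbabilityMeasure_map (hS.meas t i).aemeasurable
  have hnm : ∀ t i, Measurable fun ω => batchNoise P η A₀ i (X t ω i, ξ t i ω) := fun t i =>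
    (hφ i).comp ((hXm' t i i).prodMk (hS.meas t i))
  have hvar : ∀ t i, ∫⁻ ω, ENNReal.ofReal (‖batchNoise P η A₀ i (X t ω i, ξ t i ω)‖ ^ 2) ∂μ
      ≤ ENNReal.ofReal (ζ ^ 2) := fun t i =>
    lintegral_comp_le_of_indepFun (hXm' t i i) (hS.meas t i) (hS.indepFun (hXm t i i))
      (F := fun p => ENNReal.ofReal (‖batchNoise P η A₀ i p‖ ^ 2))
      ((hφ i).norm.pow_const 2).ennreal_ofReal
      (lintegral_norm_sq_batchNoise_le hP hV (hS.size_pos i) (hτ t i))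
  have hL : ∀ t i, MemLp (fun ω => batchNoise P η A₀ i (X t ω i, ξ t i ω)) 2 μ := fun t i =>
    memLp_two_of_lintegral_le (hnm t i) (hvar t i)
  have horth : ∀ t i (v : Ω → Mat d r), Measurable[otherBatches ξ t i] v → MemLp v 2 μ →
      ∫ ω, inner ℝ (v ω) (batchNoise P η A₀ i (X t ω i, ξ t i ω)) ∂μ = 0 := by
    intro t i v hv hv2
    -- The frozen variable is the pair: the noise depends on its first component, the test vector is
    -- its second.
    have hp : Measurable[otherBatches ξ t i] fun ω => (X t ω i, v ω) :=
      Measurable.prodMk (hXm t i i) hv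
    have := hτp t i
    exact integral_inner_comp_eq_zero_of_indepFun (hp.mono (hS.otherBatches_le t i) le_rfl)
      (hS.meas t i) (hS.indepFun hp)
      (φ := fun p : (Mat d r × Mat d r) × (Fin (b i) → Z) => batchNoise P η A₀ i (p.1.1, p.2))
      ((hφ i).comp (by fun_prop)) (u := Prod.snd) measurable_snd
      (fun x => integrable_batchNoise hP hV (hτ t i) x.1)
      (fun x => integral_batchNoise hP hV (hS.size_pos i) (hτ t i) x.1) hv2 (hL t i)
  refine ⟨hL, fun t i => integral_norm_sq_le_of_lintegral_le (hnm t i) (sq_nonneg ζ) (hvar t i),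
    ?_, ?_⟩
  · intro t i j hij
    refine horth t j _ ?_ (hL t i)
    have hp : Measurable[otherBatches ξ t j] fun ω => (X t ω i, ξ t i ω) :=
      Measurable.prodMk (hXm t j i) (measurable_otherBatches fun h => hij (congrArg Prod.snd h))
    exact (hφ i).comp hp
  · intro t i v hv hv2
    have hp : Measurable[otherBatches ξ t i] (X t) :=
      @measurable_pi_lambda _ _ _ (otherBatches ξ t i) _ _ (hXm t i)
    exact horth t i _ (hv.measurable.comp hp) hv2

end Iterates

/-! ### The objectives in the trainable factor -/

section Objective

variable {N d k r : ℕ} {Z : Type*} [MeasurableSpace Z] {P : Task N d k Z} {η L : ℝ} {A₀ : Mat r k}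

lemma Task.Smooth.differentiable_fB (hP : P.Smooth L) (i : Fin N) :
    Differentiable ℝ (P.fB η A₀ i : Mat d r → ℝ) := fun B =>
  (hasGradientAt_comp_affine (hP i).1 P.W₀ (loraLin d η A₀) B).differentiableAt

lemma Task.Smooth.gradient_fB_lipschitz (hP : P.Smooth L) (hL : 0 < L) (hr : 1 ≤ r)
    (hA : ‖A₀‖ ≤ r + √((k : ℝ) * r)) (i : Fin N) (x y : Mat d r) :
    ‖gradient (P.fB η A₀ i) x - gradient (P.fB η A₀ i) y‖ ≤ 2 * Ltilde L η k r * ‖x - y‖ :=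
  (gradient_comp_affine_lipschitz (hP i).1 hL.le (hP i).2 P.W₀ (loraLin d η A₀)
    (norm_loraLin_le η A₀) x y).trans
    (mul_le_mul_of_nonneg_right (sq_norm_le_Ltilde hL hr hA) (norm_nonneg _))

lemma Task.Smooth.hasGradientAt_obj (hP : P.Smooth L) (B : Mat d r) :
    HasGradientAt (P.obj η A₀) (avg fun i => gradient (P.fB η A₀ i) B) B := by
  rw [hasGradientAt_iff_hasFDerivAt]
  have h1 : HasFDerivAt (fun B : Mat d r => (1 / (N : ℝ)) * ∑ i, P.fB η A₀ i B)
      ((1 / (N : ℝ)) • ∑ i, fderiv ℝ (P.fB η A₀ i) B) B :=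
    (HasFDerivAt.fun_sum fun i _ => (hP.differentiable_fB i B).hasFDerivAt).const_mul _
  convert! h1 using 1
  simp [avg, toDual_gradient]

end Objective

/-- The bound of `IsMixing.sum_integral_norm_sq_gradient_le` for step sizes of order
`√(N / T)`. -/
lemma rate_le {K α ζ κ D R c δ q N T ρ u : ℝ} (hN : 1 ≤ N) (hT : 0 < T) (hc : 0 < c) (hδ : 0 < δ)
    (hδ1 : δ ≤ 1) (hρ1 : ρ < 1) (hD : 0 ≤ D) (hu : 0 < u) (hq : 0 < q) (hK0 : 0 < K)
    (hK : K ≤ u * q) (h1 : c * √(N / T) ≤ α) (h2 : α ≤ √(N / T)) :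
    (1 / T) * (2 * D / α + K ^ 2 * (4 / (3 * δ))
        * (R ^ 2 + T * (2 / δ * (α ^ 2 * κ ^ 2) + α ^ 2 * ζ ^ 2)) + T * (K * α * ζ ^ 2 / N))
      ≤ (2 * D / c + u * ζ ^ 2 + u ^ 2 * (4 / 3) * (R ^ 2 + 2 * κ ^ 2 + ζ ^ 2) + 1)
        * (1 / √(N * T) + q / √(N * T) + N * q ^ 2 / ((1 - ρ) * T) + N * q ^ 2 / (δ ^ 2 * T)) := by
  have hN0 : 0 < N := by linarith
  have hw : 0 < √(N * T) := Real.sqrt_pos.2 (by positivity)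
  have hs : 0 < √(N / T) := Real.sqrt_pos.2 (by positivity)
  have hα : 0 < α := lt_of_lt_of_le (by positivity) h1
  have e1 : √(N / T) * T = √(N * T) := by
    have : N * T = N / T * T ^ 2 := by field_simp
    rw [this, Real.sqrt_mul (by positivity), Real.sqrt_sq hT.le]
  have e2 : √(N / T) * √(N * T) = N := by
    rw [← Real.sqrt_mul (by positivity), show N / T * (N * T) = N ^ 2 by field_simp,
      Real.sqrt_sq hN0.le]
  -- The only place where the lower bound on `α` affects the rate: the initial gap is divided by `α
  -- T ≥ c √(N T)`.
  have t1 : (1 / T) * (2 * D / α) ≤ 2 * D / c * (1 / √(N * T)) := by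
    have h3 : c * √(N * T) ≤ α * T := by
      rw [← e1, ← mul_assoc]
      gcongr
    calc (1 / T) * (2 * D / α) = 2 * D / (α * T) := by field_simp
      _ ≤ 2 * D / (c * √(N * T)) := by gcongr
      _ = _ := by field_simp
  -- The consensus error: `T α² ≤ N`, and a second factor `1 / δ` comes from the gradient diversity.
  -- The bounds `1 ≤ N / δ` and `N ≤ N / δ` bring initialization and noise to the same form.
  have t2 : (1 / T) * (K ^ 2 * (4 / (3 * δ))
        * (R ^ 2 + T * (2 / δ * (α ^ 2 * κ ^ 2) + α ^ 2 * ζ ^ 2)))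
      ≤ u ^ 2 * (4 / 3) * (R ^ 2 + 2 * κ ^ 2 + ζ ^ 2) * (N * q ^ 2 / (δ ^ 2 * T)) := by
    have h3 : T * α ^ 2 ≤ N := by
      have : α ^ 2 ≤ N / T := by
        rw [← Real.sq_sqrt (show 0 ≤ N / T by positivity)]
        exact pow_le_pow_left₀ hα.le h2 2
      rwa [le_div_iff₀ hT, mul_comm] at this
    have h4 : R ^ 2 + T * (2 / δ * (α ^ 2 * κ ^ 2) + α ^ 2 * ζ ^ 2)
        ≤ N / δ * (R ^ 2 + 2 * κ ^ 2 + ζ ^ 2) := by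
      have h5 : 1 ≤ N / δ := by rw [le_div_iff₀ hδ]; linarith
      have h6 : N ≤ N / δ := by rw [le_div_iff₀ hδ]; nlinarith
      calc R ^ 2 + T * (2 / δ * (α ^ 2 * κ ^ 2) + α ^ 2 * ζ ^ 2)
          = 1 * R ^ 2 + 2 / δ * κ ^ 2 * (T * α ^ 2) + (T * α ^ 2) * ζ ^ 2 := by ring
        _ ≤ N / δ * R ^ 2 + 2 / δ * κ ^ 2 * N + N / δ * ζ ^ 2 := by
          have := h3.trans h6
          gcongr
        _ = _ := by ring
    calc (1 / T) * (K ^ 2 * (4 / (3 * δ))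
        * (R ^ 2 + T * (2 / δ * (α ^ 2 * κ ^ 2) + α ^ 2 * ζ ^ 2)))
        ≤ (1 / T) * ((u * q) ^ 2 * (4 / (3 * δ)) * (N / δ * (R ^ 2 + 2 * κ ^ 2 + ζ ^ 2))) := by
          gcongr
      _ = _ := by field_simp
  have t3 : (1 / T) * (T * (K * α * ζ ^ 2 / N)) ≤ u * ζ ^ 2 * (q / √(N * T)) := by
    calc (1 / T) * (T * (K * α * ζ ^ 2 / N)) = K * α * ζ ^ 2 / N := by field_simp
      _ ≤ (u * q) * √(N / T) * ζ ^ 2 / N := by gcongr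
      _ = (u * q) * √(N / T) * ζ ^ 2 / (√(N / T) * √(N * T)) := by rw [e2]
      _ = _ := by field_simp
  have p1 : 0 ≤ 1 / √(N * T) := by positivity
  have p2 : 0 ≤ q / √(N * T) := by positivity
  have p3 : 0 ≤ N * q ^ 2 / ((1 - ρ) * T) :=
    div_nonneg (by positivity) (mul_nonneg (by linarith) hT.le)
  have p4 : 0 ≤ N * q ^ 2 / (δ ^ 2 * T) := by positivity
  have c1 : 0 ≤ 2 * D / c := by positivity
  have c2 : 0 ≤ u * ζ ^ 2 := by positivity
  have c3 : 0 ≤ u ^ 2 * (4 / 3) * (R ^ 2 + 2 * κ ^ 2 + ζ ^ 2) := by positivity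
  set x1 := 1 / √(N * T)
  set x2 := q / √(N * T)
  set x3 := N * q ^ 2 / ((1 - ρ) * T)
  set x4 := N * q ^ 2 / (δ ^ 2 * T)
  set C1 := 2 * D / c
  set C2 := u * ζ ^ 2
  set C3 := u ^ 2 * (4 / 3) * (R ^ 2 + 2 * κ ^ 2 + ζ ^ 2)
  set C := C1 + C2 + C3 + 1 with hC
  have f1 : C1 * x1 ≤ C * x1 := by gcongr; linarith
  have f2 : C2 * x2 ≤ C * x2 := by gcongr; linarith
  -- The summand with `1 - ρ` enters only through its sign, since `x4` pays for the whole consensus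
  -- error.
  have f3 : 0 ≤ C * x3 := by positivity
  have f4 : C3 * x4 ≤ C * x4 := by gcongr; linarith
  rw [mul_add, mul_add]
  linarith

end DLoRAFA

theorem corollary2 (L η ζ κ D R c : ℝ) (hL : 0 < L) (hη : 0 < η) (hζ : 0 < ζ) (hκ : 0 < κ)
    (hc : 0 < c) :
    ∃ C : ℝ, 0 < C ∧ ∀ r k : ℕ, 1 ≤ r → r ≤ k →
      -- the event for the frozen factor, and its probability
      ENNReal.ofReal (1 - Real.exp (-(r : ℝ) ^ 2 / 2)) ≤
          DLoRAFA.gaussianMat r k {A₀ | ‖A₀‖ ≤ r + √((k : ℝ) * r)} ∧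
      ∀ A₀ : DLoRAFA.Mat r k, ‖A₀‖ ≤ r + √((k : ℝ) * r) →
      -- the task, the network and the algorithm
      ∀ (N d T : ℕ) (ρ α : ℝ) (Z : Type*) [MeasurableSpace Z] (P : DLoRAFA.Task N d k Z)
        (G : SimpleGraph (Fin N)) (M : Matrix (Fin N) (Fin N) ℝ)
        (Ω : Type*) [MeasurableSpace Ω] (μ : Measure Ω) [IsProbabilityMeasure μ]
        (b : Fin N → ℕ) (ξ : ℕ → (i : Fin N) → Ω → Fin (b i) → Z)
        (B₁ : Fin N → DLoRAFA.Mat d r),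
      1 ≤ N → 0 < ρ → ρ < 1 →
      P.WellPosed η A₀ → P.Smooth L →
      P.BoundedVariance η A₀ ζ → P.BoundedDiversity η A₀ κ →
      DLoRAFA.IsMixing G M ρ →
      DLoRAFA.IsSampling μ P.dist b ξ →
      -- bounds on the initialization
      BddBelow (Set.range (P.obj η A₀ : DLoRAFA.Mat d r → ℝ)) →
      P.obj η A₀ (DLoRAFA.avg B₁) - (⨅ B : DLoRAFA.Mat d r, P.obj η A₀ B) ≤ D →
      (1 / (N : ℝ)) * ∑ i, ‖B₁ i‖ ^ 2 ≤ R ^ 2 →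
      -- step size and number of iterations
      c * √((N : ℝ) / T) ≤ α → α ≤ √((N : ℝ) / T) →
      32 * N * DLoRAFA.Ltilde L η k r ^ 2 / (1 - √ρ) ^ 2 ≤ T →
      let gradSq : ℕ → Ω → ℝ := fun t ω =>
        ‖gradient (P.obj η A₀ : DLoRAFA.Mat d r → ℝ) (DLoRAFA.avg
          (DLoRAFA.iterates P η A₀ G M α B₁ (fun s i => ξ s i ω) t))‖ ^ 2
      (∀ t, Integrable (gradSq t) μ) ∧
      (1 / (T : ℝ)) * ∑ t ∈ Finset.range T, ∫ ω, gradSq t ω ∂μ ≤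
        C * (1 / √((N : ℝ) * T) + k / (r * √((N : ℝ) * T))
          + N * (k : ℝ) ^ 2 / ((1 - ρ) * T * (r : ℝ) ^ 2)
          + N * (k : ℝ) ^ 2 / ((1 - √ρ) ^ 2 * T * (r : ℝ) ^ 2)) := by
  -- The constant of `rate_le` with `u = 8 η² L`, because `K = 2 L̃ ≤ 8 η² L (k / r)`. The absolute
  -- value keeps it positive for every real `D`.
  refine ⟨2 * |D| / c + 8 * η ^ 2 * L * ζ ^ 2
    + (8 * η ^ 2 * L) ^ 2 * (4 / 3) * (R ^ 2 + 2 * κ ^ 2 + ζ ^ 2) + 1, by positivity, ?_⟩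
  intro r k hr hk
  refine ⟨DLoRAFA.gaussianMat_norm_le r k hr hk, ?_⟩
  intro A₀ hA N d T ρ α Z _ P G M Ω _ μ _ b ξ B₁ hN hρ hρ1 hP hPL hV hdiv hM hS hbdd hD hR hα1 hα2 hT
    gradSq
  have hs1 : √ρ < 1 := by rw [Real.sqrt_lt' one_pos]; simpa
  have hs0 : 0 < √ρ := Real.sqrt_pos.2 hρ
  have hδ : 0 < 1 - √ρ := by linarith
  have hN1 : (1 : ℝ) ≤ N := by exact_mod_cast hN
  have hN0 : (0 : ℝ) < N := by linarith
  have hr0 : (0 : ℝ) < r := by exact_mod_cast hr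
  have hk0 : (0 : ℝ) < k := by exact_mod_cast hr.trans hk
  have hLt := DLoRAFA.Ltilde_pos hL hη k r
  have hT0 : (0 : ℝ) < T := lt_of_lt_of_le (by positivity) hT
  have hα0 : 0 < α := lt_of_lt_of_le (mul_pos hc (Real.sqrt_pos.2 (by positivity))) hα1
  -- From `α² ≤ N / T` and the lower bound on `T`: the factor `32` there is `4 · 8`, the `4` coming
  -- from `K² = 4 L̃²`.
  have hαK : α ^ 2 * (2 * DLoRAFA.Ltilde L η k r) ^ 2 ≤ (1 - √ρ) ^ 2 / 8 := by
    have h1 : α ^ 2 ≤ N / T := by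
      rw [← Real.sq_sqrt (show (0 : ℝ) ≤ N / T by positivity)]
      exact pow_le_pow_left₀ hα0.le hα2 2
    rw [div_le_iff₀ (by positivity)] at hT
    rw [le_div_iff₀ hT0] at h1
    have h2 := mul_le_mul_of_nonneg_right h1 (sq_nonneg (DLoRAFA.Ltilde L η k r))
    have h3 : T * (α ^ 2 * DLoRAFA.Ltilde L η k r ^ 2 * 32) ≤ T * (1 - √ρ) ^ 2 := by linarith
    have h4 := le_of_mul_le_mul_left h3 hT0
    linarith
  have hlip := hPL.gradient_fB_lipschitz (η := η) hL hr hA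
  have hgc := fun i => DLoRAFA.continuous_of_norm_sub_le (hlip i)
  have hgrad : ∀ B : DLoRAFA.Mat d r, gradient (P.obj η A₀) B
      = DLoRAFA.avg fun i => gradient (P.fB η A₀ i) B := fun B => (hPL.hasGradientAt_obj B).gradient
  have hinf : ∀ B : DLoRAFA.Mat d r, P.obj η A₀ (DLoRAFA.avg B₁) - P.obj η A₀ B ≤ D := fun B => by
    linarith [ciInf_le hbdd B]
  have hD0 : 0 ≤ D := by simpa using hinf (DLoRAFA.avg B₁)
  obtain ⟨hint, hsum⟩ := hM.sum_integral_norm_sq_gradient_le (μ := μ) (κ := κ) (D := D) (R := R)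
    hN hρ hρ1 hα0 (mul_pos two_pos hLt) hlip (fun B => by simpa only [hgrad] using hdiv B) hαK
    (fun ω => rfl) (fun t ω => DLoRAFA.iterates_succ_eq_gossipStep hM _ t)
    (DLoRAFA.uncorrelatedNoise_iterates (α := α) (G := G) (M := M) (B₁ := B₁) hP hV hgc hS)
    (fun B => (hPL.hasGradientAt_obj B).differentiableAt) hgrad hinf hR T
  refine ⟨hint, (mul_le_mul_of_nonneg_left hsum (by positivity)).trans ?_⟩
  have hrate := DLoRAFA.rate_le (q := (k : ℝ) / r) (u := 8 * η ^ 2 * L) (ζ := ζ) (κ := κ) (R := R)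
    hN1 hT0 hc hδ (by linarith) hρ1 hD0 (by positivity) (by positivity) (mul_pos two_pos hLt)
    (by linarith [DLoRAFA.Ltilde_le (η := η) hL hr hk]) hα1 hα2
  rw [abs_of_nonneg hD0]
  refine hrate.trans_eq ?_
  congr 1
  simp only [div_pow, div_div, mul_div_assoc', mul_comm ((r : ℝ) ^ 2)]
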